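/- A Type III code of length $n$ is a linear code $C\subseteq\mathbb F_3^n$ with $C=C^\perp$ (for $(x,y)=\sum_i x_iy_i$), so that all weights are divisible by $3$; it is extremal if its minimum distance is $3\lfloor n/12\rfloor+3$. For $w\ge 1$ let $D_w$ be the collection, with multiplicities, of the supports of all codewords of $C$ of weight $w$. It is a $t$-design ($0\le t\le w$) if every $t$-subset of the $n$ coordinates is contained in the same number of members of $D_w$, and it is trivial if all $w$-subsets of the coordinates occur in it equally often (possibly never). Let $\delta(C)$ be the largest $t$ such that every nonempty $D_w$ is a $t$-design, and let $s(C)$ be the largest $t$ such that some nontrivial $D_w$ is a $t$-design. **Theorem.** Let $C$ be an extremal Type III code of length $n$, and let $m\ge 0$ be an integer. (1) Assume $n=12m$. (a) If $m\notin\{15,38,43,64\}$, then $\delta(C)=s(C)=5$. (b) If $m\in\{15,38,43,64\}$, then $\delta(C)=s(C)=5$ or $\delta(C)=s(C)=7$. (2) Assume $n=12m+4$. (a) If $m\notin\{11,18,21,25,32,39,43,46,49,54,60,65,67,68,74\}$, then $\delta(C)=3$ and, if moreover $m\neq 0$, $s(C)=3$. (For $m=0$ all $D_w$ are trivial, and $s(C)$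 is not defined.) (b) If $m\in\{11,18,21,25,32,39,43,46,49,54,60,65,68,74\}$, then $\delta(C)=s(C)=3$ or $\delta(C)=s(C)=5$. (c) If $m=67$, then $\delta(C)=s(C)=3$, $\delta(C)=s(C)=5$ or $\delta(C)=s(C)=6$. (3) Assume $n=12m+8$. (a) If $m\notin\{14,37,42,63\}$, then $\delta(C)=s(C)=1$. (b) If $m\in\{14,37,42\}$, then $\delta(C)=s(C)=1$ or $\delta(C)=s(C)=3$. (c) If $m=63$, then either $\delta(C)=s(C)=1$, or $\delta(C)=3$ and $4\le s(C)\le 6$. -/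

import Mathlib

namespace TernaryCode

/-- A ternary linear code of length `n`: a linear subspace of `𝔽₃ⁿ`. -/
abbrev LinearCode (n : ℕ) : Type := Submodule (ZMod 3) (Fin n → ZMod 3)

/-- The dual code with respect to `(x, y) = ∑ xᵢ yᵢ`. -/
def dual {n : ℕ} (C : LinearCode n) : LinearCode n where
  carrier := {y | ∀ x ∈ C, ∑ i, x i * y i = 0}
  zero_mem' := by
    intro x _
    simp
  add_mem' := by
    intro a b ha hb x hx
    simp only [Pi.add_apply, mul_add, Finset.sum_add_distrib, ha x hx, hb x hx, add_zero]
  smul_mem' := by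
    intro r a ha x hx
    simp only [Pi.smul_apply, smul_eq_mul, mul_left_comm _ r, ← Finset.mul_sum, ha x hx, mul_zero]

/-- Type III codes: self-dual ternary codes, all of whose weights are divisible by `3`. -/
def IsTypeIII {n : ℕ} (C : LinearCode n) : Prop :=
  C = dual C ∧ ∀ x ∈ C, 3 ∣ hammingNorm x

/-- `d` is the minimum distance of `C` (attained by some nonzero codeword). -/
def IsMinDist {n : ℕ} (C : LinearCode n) (d : ℕ) : Prop :=
  IsLeast {w : ℕ | ∃ x ∈ C, x ≠ 0 ∧ hammingNorm x = w} d

/-- Extremal Type III codes: the minimum distance is `3⌊n/12⌋ + 3`. -/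
def IsExtremalTypeIII {n : ℕ} (C : LinearCode n) : Prop :=
  IsTypeIII C ∧ IsMinDist C (3 * (n / 12) + 3)

/-- The support of a vector. -/
def supp {n : ℕ} (x : Fin n → ZMod 3) : Finset (Fin n) :=
  Finset.univ.filter fun i => x i ≠ 0

open Classical in
/-- The support design `D_w` of `C`: the collection (with multiplicities) of the supports
of all codewords of weight `w`. -/
noncomputable def supportDesign {n : ℕ} (C : LinearCode n) (w : ℕ) :
    Multiset (Finset (Fin n)) :=
  (Finset.univ.filter fun x : Fin n → ZMod 3 => x ∈ C ∧ hammingNorm x = w).val.map supp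

/-- The collection of blocks `B`, repeated blocks being allowed, is a `t`-design with blocks of
size `k`: `t ≤ k`, all blocks have `k` points, and any `t` points lie in the same number of
blocks. -/
def IsDesign {X : Type*} [DecidableEq X] (t k : ℕ) (B : Multiset (Finset X)) : Prop :=
  t ≤ k ∧ (∀ b ∈ B, b.card = k) ∧
    ∃ l : ℕ, ∀ T : Finset X, T.card = t → B.countP (fun b => T ⊆ b) = l

/-- The collection of blocks `B` of size `k` is trivial: all `k`-subsets occur in it equally often
(possibly never). Such a collection is a `t`-design for all `t ≤ k`. -/
def IsTrivial {X : Type*} [DecidableEq X] (k : ℕ) (B : Multiset (Finset X)) : Prop :=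
  ∃ r : ℕ, ∀ T : Finset X, T.card = k → B.count T = r

/-- `δ(C)`: the largest `t` such that all (nonempty) support designs `D_w`, `w ≠ 0`, are
`t`-designs. -/
noncomputable def delta {n : ℕ} (C : LinearCode n) : ℕ :=
  sSup {t : ℕ | ∀ w : ℕ, w ≠ 0 → supportDesign C w ≠ 0 → IsDesign t w (supportDesign C w)}

/-- `s(C)`: the largest `t` such that some nontrivial support design `D_w`, `w ≠ 0`, is a
`t`-design. -/
noncomputable def s {n : ℕ} (C : LinearCode n) : ℕ :=
  sSup {t : ℕ | ∃ w : ℕ, w ≠ 0 ∧ ¬ IsTrivial w (supportDesign C w) ∧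
    IsDesign t w (supportDesign C w)}

end TernaryCode

/-! Write n = 12m + 4r with r ≤ 2. By Delsarte's criterion, a family of blocks of one size is a
t-design if and only if every harmonic function of degree 1, …, t sums to zero over it; the products
`diffProd l` over disjoint pairs serve as these functions (`isDesign_of_diffSum_eq_zero`,
`IsDesign.diffSum_eq_zero`).

Weight the codewords by such a function of degree k. Each pair contributes a factor -3 under the
Fourier transform, so a MacWilliams identity survives on the remaining n - 2k coordinates
(`diffEnumerator_invariant`; these are Bachoc's harmonic weight enumerators). Self-duality, weights
divisible by 3 and the minimum distance 3m + 3 then force the enumerator, divided by Y ^ k, to be (Y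
(1 - Y³)) ^ (3m + 3 - k) Q(Y³) with Q invariant of degree 2k + 4r - 12 (`exists_eq_pow_mul_expand`).
There is no such Q ≠ 0 in negative degree or degree 2, and in degrees 0, 4, 6 it is a multiple of 1,
1 + 8z, 1 - 20z - 8z². Hence degrees k < 6 - 2r and k = 7 - 2r never obstruct, while at k = 6 - 2r,
8 - 2r, 9 - 2r the sums over all D_w are one constant times the coefficients of an explicit
polynomial. If no coefficient vanishes, the D_w gain or lose strength together, which gives δ = s
(`vanish_or_eq`).

It remains to exclude the higher strengths. Gleason's theorem and Lagrange inversion give the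
numbers of words of the first two weights. Nonnegativity of the second bounds m
(`lagrangeCoeff_le`), and for the finitely many m left the integrality condition for a t-design in
minimum weight leaves the exceptional lists. The coefficients of (1 - z) ^ d (1 + 8z) vanish only
where 9j = d + 1. Among the exceptional m this happens for r = 2 and m = 42, 63: length 512 carries
no extremal code, since a weight count would be negative, and in length 764 the design D_255 may be
stronger than the others. -/

namespace TernaryCode

/-! ### Designs and harmonic functions: Delsarte's criterion, integrality, trivial designs. -/

section Designs

/-- The points occurring in a list of pairs. -/
def points {X : Type*} (l : List (X × X)) : List X := l.flatMap fun p => [p.1, p.2]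

@[simp] lemma points_nil {X : Type*} : points ([] : List (X × X)) = [] := rfl

@[simp] lemma points_cons {X : Type*} (p : X × X) (l : List (X × X)) :
    points (p :: l) = p.1 :: p.2 :: points l := rfl

variable {X : Type*} [DecidableEq X]

/-- The product over the pairs `(a, b)` in `l` of `1[a ∈ B] - 1[b ∈ B]`. When the pairs are
disjoint these functions span the harmonic functions of degree `l.length`. -/
def diffProd (l : List (X × X)) (b : Finset X) : ℤ :=
  (l.map fun p => (if p.1 ∈ b then 1 else 0) - (if p.2 ∈ b then 1 else 0)).prod

/-- The sum of `diffProd l` over the blocks that contain `S`. -/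
def diffSumOver (l : List (X × X)) (S : Finset X) (B : Multiset (Finset X)) : ℤ :=
  (B.map fun b => diffProd l b * if S ⊆ b then 1 else 0).sum

/-- The sum of `diffProd l` over all blocks. -/
def diffSum (l : List (X × X)) (B : Multiset (Finset X)) : ℤ := (B.map (diffProd l)).sum

@[simp] lemma diffProd_nil (b : Finset X) : diffProd [] b = 1 := rfl

lemma diffProd_cons (p : X × X) (l : List (X × X)) (b : Finset X) :
    diffProd (p :: l) b =
      ((if p.1 ∈ b then 1 else 0) - (if p.2 ∈ b then 1 else 0)) * diffProd l b := by
  simp [diffProd]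

lemma diffSumOver_empty (l : List (X × X)) (B : Multiset (Finset X)) :
    diffSumOver l ∅ B = diffSum l B := by
  simp [diffSumOver, diffSum]

lemma diffSumOver_nil (S : Finset X) (B : Multiset (Finset X)) :
    diffSumOver [] S B = B.countP (fun b => S ⊆ b) := by
  induction B using Multiset.induction_on with
  | empty => simp [diffSumOver]
  | cons b B ih =>
    simp only [diffSumOver, diffProd_nil, one_mul, Multiset.map_cons, Multiset.sum_cons,
      Multiset.countP_cons] at ih ⊢
    rw [ih]
    split_ifs <;> push_cast <;> ring

lemma diffSumOver_cons (p : X × X) (l : List (X × X)) (S : Finset X) (B : Multiset (Finset X)) :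
    diffSumOver (p :: l) S B =
      diffSumOver l (insert p.1 S) B - diffSumOver l (insert p.2 S) B := by
  simp only [diffSumOver]
  rw [← Multiset.sum_map_sub]
  congr 1
  refine Multiset.map_congr rfl fun b _ => ?_
  simp only [diffProd_cons, Finset.insert_subset_iff]
  by_cases h1 : p.1 ∈ b <;> by_cases h2 : p.2 ∈ b <;> by_cases h3 : S ⊆ b <;> simp [h1, h2, h3]

/-- A factor is nonzero only if exactly one point of its pair lies in the block. -/
lemma countP_points {l : List (X × X)} {b : Finset X} (h : diffProd l b ≠ 0) :
    (points l).countP (fun a => a ∈ b) = l.length := by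
  induction l with
  | nil => simp
  | cons p l ih =>
    rw [diffProd_cons] at h
    have h1 := left_ne_zero_of_mul h
    have h2 := ih (right_ne_zero_of_mul h)
    by_cases ha : p.1 ∈ b <;> by_cases hb : p.2 ∈ b <;> simp_all

lemma card_filter_points {l : List (X × X)} {b : Finset X} (hl : (points l).Nodup)
    (h : diffProd l b ≠ 0) : (b ∩ (points l).toFinset).card = l.length := by
  rw [← countP_points h, Finset.inter_comm, ← Finset.filter_mem_eq_inter,
    List.countP_eq_length_filter, ← List.toFinset_card_of_nodup (hl.filter _),
    List.toFinset_filter]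
  simp

variable [Fintype X]

/-- Double counting: a block containing S on which the product is nonzero has k - |l| - |S| points
outside S and the pairs. -/
lemma sum_diffSumOver_insert {l : List (X × X)} {S : Finset X} {B : Multiset (Finset X)} {k : ℕ}
    (hB : ∀ b ∈ B, b.card = k) (hl : (points l).Nodup) (hS : Disjoint S (points l).toFinset) :
    ∑ a ∈ Finset.univ \ ((points l).toFinset ∪ S), diffSumOver l (insert a S) B =
      ((k : ℤ) - l.length - S.card) * diffSumOver l S B := by
  simp only [diffSumOver]
  rw [Finset.sum_eq_multiset_sum, Multiset.sum_map_sum_map, ← Multiset.sum_map_mul_left]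
  congr 1
  refine Multiset.map_congr rfl fun b hb => ?_
  rw [← Finset.sum_eq_multiset_sum, ← Finset.mul_sum]
  by_cases h0 : diffProd l b = 0
  · simp [h0]
  by_cases hSb : S ⊆ b
  · have h1 : ∑ a ∈ Finset.univ \ ((points l).toFinset ∪ S),
        (if insert a S ⊆ b then (1 : ℤ) else 0) = (b \ ((points l).toFinset ∪ S)).card := by
      rw [Finset.sum_boole]
      congr 2
      ext a
      simp [Finset.insert_subset_iff, hSb, and_comm]
    have h2 : (b \ ((points l).toFinset ∪ S)).card + (l.length + S.card) = k := by
      rw [← hB b hb, ← card_filter_points hl h0, ← Finset.card_sdiff_add_card_inter b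
        ((points l).toFinset ∪ S), Finset.inter_union_distrib_left,
        Finset.card_union_of_disjoint, Finset.inter_eq_right.2 hSb]
      exact (hS.symm.mono_left Finset.inter_subset_right).mono_right Finset.inter_subset_right
    rw [h1, ← h2, if_pos hSb]
    push_cast
    ring
  · have : ∀ a, ¬ insert a S ⊆ b := fun a h => hSb ((Finset.subset_insert a S).trans h)
    simp [this, hSb]

lemma sum_countP_insert {S : Finset X} {B : Multiset (Finset X)} {k : ℕ}
    (hB : ∀ b ∈ B, b.card = k) :
    ∑ a ∈ Sᶜ, ((B.countP fun b => insert a S ⊆ b : ℕ) : ℤ) =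
      ((k : ℤ) - S.card) * (B.countP fun b => S ⊆ b : ℕ) := by
  have := sum_diffSumOver_insert (l := []) (S := S) hB (by simp) (by simp)
  simpa [diffSumOver_nil, Finset.compl_eq_univ_sdiff] using this

/-- Adjoining the pair (c, a) to l raises the degree by one, and the vanishing of that sum says that
`diffSumOver l (insert c S)` does not depend on c. By double counting these equal terms add up to a
multiple of the sum over S, which is zero by induction. -/
lemma diffSumOver_eq_zero {B : Multiset (Finset X)} {t k : ℕ} (hB : ∀ b ∈ B, b.card = k)
    (H : ∀ l : List (X × X), (points l).Nodup → l ≠ [] → l.length ≤ t → diffSum l B = 0) (s : ℕ) :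
    ∀ (l : List (X × X)) (S : Finset X), (points l).Nodup → Disjoint S (points l).toFinset →
      l ≠ [] → S.card = s → l.length + s ≤ t → diffSumOver l S B = 0 := by
  induction s with
  | zero =>
    intro l S hl _ hne hS hle
    rw [Finset.card_eq_zero.1 hS, diffSumOver_empty]
    exact H l hl hne hle
  | succ s ih =>
    intro l S hl hd hne hS hle
    obtain ⟨a, S, haS, rfl, hS'⟩ := Finset.card_eq_succ.1 hS
    rw [Finset.disjoint_insert_left] at hd
    have hconst : ∀ c ∈ Finset.univ \ ((points l).toFinset ∪ S),
        diffSumOver l (insert c S) B = diffSumOver l (insert a S) B := by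
      intro c hc
      simp only [Finset.mem_sdiff, Finset.mem_univ, Finset.mem_union, true_and, not_or,
        List.mem_toFinset] at hc
      by_cases hca : c = a
      · rw [hca]
      have := ih ((c, a) :: l) S (by
          have := hd.1
          simp only [List.mem_toFinset] at this
          simp [hl, hca, hc.1, this]) (by
          simp [hd.2, hc.2, haS]) (by simp) hS' (by simp; omega)
      rw [diffSumOver_cons] at this
      exact sub_eq_zero.1 this
    have hsum := sum_diffSumOver_insert hB hl hd.2
    rw [Finset.sum_congr rfl hconst, Finset.sum_const, ih l S hl hd.2 hne hS' (by omega), mul_zero,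
      smul_eq_zero] at hsum
    refine hsum.resolve_left ?_
    rw [Finset.card_eq_zero]
    exact Finset.ne_empty_of_mem (a := a) (by simpa [haS] using hd.1)

/-- The same argument for l = []: single pairs show that the count is unchanged when one point of T
is exchanged, and double counting then gives it a value independent of T. -/
lemma exists_countP_const {B : Multiset (Finset X)} {t k : ℕ} (hB : ∀ b ∈ B, b.card = k)
    (H : ∀ l : List (X × X), (points l).Nodup → l ≠ [] → l.length ≤ t → diffSum l B = 0) (s : ℕ)
    (hs : s ≤ t) : ∃ c : ℕ, ∀ T : Finset X, T.card = s → B.countP (fun b => T ⊆ b) = c := by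
  by_cases h0 : ∃ T₀ : Finset X, T₀.card = s
  swap
  · exact ⟨0, fun T hT => (h0 ⟨T, hT⟩).elim⟩
  induction s with
  | zero =>
    refine ⟨B.card, fun T hT => ?_⟩
    rw [Finset.card_eq_zero.1 hT]
    simp
  | succ s ih =>
    obtain ⟨T₀, hT₀⟩ := h0
    refine ⟨B.countP (fun b => T₀ ⊆ b), ?_⟩
    obtain ⟨a₀, S₀, ha₀, rfl, hS₀⟩ := Finset.card_eq_succ.1 hT₀
    obtain ⟨c, hc⟩ := ih (by omega) ⟨S₀, hS₀⟩
    have key : ∀ T : Finset X, T.card = s + 1 →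
        ((Fintype.card X - s : ℕ) : ℤ) * B.countP (fun b => T ⊆ b) = ((k : ℤ) - s) * c := by
      intro T hT
      obtain ⟨a, S, ha, rfl, hS⟩ := Finset.card_eq_succ.1 hT
      have h := sum_countP_insert (S := S) hB
      rw [hc S hS, hS] at h
      rw [← h, Finset.sum_congr rfl (g := fun _ => ((B.countP fun b => insert a S ⊆ b : ℕ) : ℤ)),
        Finset.sum_const, Finset.card_compl, hS, nsmul_eq_mul]
      intro x hx
      by_cases hxa : x = a
      · rw [hxa]
      have := diffSumOver_eq_zero hB H s [(x, a)] S (by simp [hxa])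
        (by simp [ha, Finset.mem_compl.1 hx]) (by simp) hS (by simp; omega)
      rw [diffSumOver_cons, diffSumOver_nil, diffSumOver_nil] at this
      exact sub_eq_zero.1 this
    intro T hT
    have h := (key T hT).trans (key _ hT₀).symm
    have hpos : ((Fintype.card X - s : ℕ) : ℤ) ≠ 0 := by
      have : T.card ≤ Fintype.card X := Finset.card_le_univ T
      omega
    exact_mod_cast mul_left_cancel₀ hpos h

lemma isDesign_of_diffSum_eq_zero {B : Multiset (Finset X)} {t k : ℕ} (htk : t ≤ k)
    (hB : ∀ b ∈ B, b.card = k)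
    (H : ∀ l : List (X × X), (points l).Nodup → l ≠ [] → l.length ≤ t → diffSum l B = 0) :
    IsDesign t k B :=
  ⟨htk, hB, exists_countP_const hB H t le_rfl⟩

lemma IsDesign.pred {B : Multiset (Finset X)} {t k : ℕ} (h : IsDesign (t + 1) k B) :
    IsDesign t k B := by
  obtain ⟨htk, hB, c, hc⟩ := h
  refine ⟨by omega, hB, ?_⟩
  by_cases h0 : ∃ T₀ : Finset X, T₀.card = t
  swap
  · exact ⟨0, fun T hT => (h0 ⟨T, hT⟩).elim⟩
  obtain ⟨T₀, hT₀⟩ := h0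
  have key : ∀ T : Finset X, T.card = t →
      ((k : ℤ) - t) * (B.countP fun b => T ⊆ b : ℕ) = (Fintype.card X - t : ℕ) * c := by
    intro T hT
    have h := sum_countP_insert (S := T) hB
    rw [hT] at h
    rw [← h, Finset.sum_congr rfl (g := fun _ => (c : ℤ)), Finset.sum_const, Finset.card_compl, hT,
      nsmul_eq_mul]
    intro a ha
    rw [hc _ (by rw [Finset.card_insert_of_notMem (Finset.mem_compl.1 ha), hT])]
  refine ⟨B.countP fun b => T₀ ⊆ b, fun T hT => ?_⟩
  have h := (key T hT).trans (key _ hT₀).symm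
  exact_mod_cast mul_left_cancel₀ (by omega) h

lemma IsDesign.mono {B : Multiset (Finset X)} {s t k : ℕ} (h : IsDesign t k B) (hst : s ≤ t) :
    IsDesign s k B := by
  induction t, hst using Nat.le_induction with
  | base => exact h
  | succ t _ ih => exact ih h.pred

/-- Expanding the pairs one by one ends in differences of counts over sets of equal size at most t.
-/
lemma IsDesign.diffSumOver_eq_zero {B : Multiset (Finset X)} {t k : ℕ} (h : IsDesign t k B)
    (l : List (X × X)) : ∀ S : Finset X, l ≠ [] → (points l).Nodup →
      Disjoint S (points l).toFinset → l.length + S.card ≤ t → diffSumOver l S B = 0 := by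
  induction l with
  | nil => intro S h; exact (h rfl).elim
  | cons p l ih =>
    intro S _ hl hd hle
    simp only [points_cons, List.nodup_cons, List.mem_cons, not_or] at hl
    simp only [points_cons, List.toFinset_cons, Finset.disjoint_insert_right] at hd
    simp only [List.length_cons] at hle
    rw [diffSumOver_cons]
    by_cases hne : l = []
    · subst hne
      obtain ⟨_, _, c, hc⟩ := h.mono (s := S.card + 1) (by simp at hle; omega)
      rw [diffSumOver_nil, diffSumOver_nil, hc _ (Finset.card_insert_of_notMem hd.1),
        hc _ (Finset.card_insert_of_notMem hd.2.1), sub_self]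
    · rw [ih _ hne hl.2.2, ih _ hne hl.2.2, sub_self]
      · rw [Finset.disjoint_insert_left]; exact ⟨by simpa using hl.2.1, hd.2.2⟩
      · rw [Finset.card_insert_of_notMem hd.2.1]; omega
      · rw [Finset.disjoint_insert_left]; exact ⟨by simpa using hl.1.2, hd.2.2⟩
      · rw [Finset.card_insert_of_notMem hd.1]; omega

lemma IsDesign.diffSum_eq_zero {B : Multiset (Finset X)} {t k : ℕ} (h : IsDesign t k B)
    {l : List (X × X)} (hne : l ≠ []) (hl : (points l).Nodup) (hle : l.length ≤ t) :
    diffSum l B = 0 := by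
  rw [← diffSumOver_empty]
  exact h.diffSumOver_eq_zero l ∅ hne hl (by simp) (by simpa using hle)

lemma IsDesign.countP_mul_descFactorial {B : Multiset (Finset X)} {t k : ℕ} (h : IsDesign t k B)
    {T : Finset X} (hT : T.card = t) :
    B.countP (fun b => T ⊆ b) * (Fintype.card X).descFactorial t =
      B.card * k.descFactorial t := by
  induction t generalizing T with
  | zero => rw [Finset.card_eq_zero.1 hT]; simp
  | succ t ih =>
    have hcard : t + 1 ≤ Fintype.card X := hT ▸ Finset.card_le_univ T
    obtain ⟨a, S, ha, rfl, hS⟩ := Finset.card_eq_succ.1 hT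
    have ih := ih h.pred hS
    obtain ⟨htk, hB, c, hc⟩ := h
    have hsum := sum_countP_insert (S := S) hB
    rw [Finset.sum_congr rfl (g := fun _ => (c : ℤ)), Finset.sum_const, Finset.card_compl, hS,
      nsmul_eq_mul] at hsum
    · rw [hc _ hT, Nat.descFactorial_succ, Nat.descFactorial_succ]
      have h2 : (Fintype.card X - t) * c = (k - t) * B.countP fun b => S ⊆ b := by
        zify [show t ≤ k by omega]
        exact hsum
      rw [← mul_assoc, mul_comm c, h2, mul_assoc, ih]
      ring
    · intro x hx
      rw [hc _ (by rw [Finset.card_insert_of_notMem (Finset.mem_compl.1 hx), hS])]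

lemma IsDesign.descFactorial_dvd {B : Multiset (Finset X)} {t k : ℕ} (h : IsDesign t k B)
    (ht : t ≤ Fintype.card X) :
    (Fintype.card X).descFactorial t ∣ B.card * k.descFactorial t := by
  obtain ⟨T, _, hT⟩ := Finset.exists_subset_card_eq (s := (Finset.univ : Finset X)) (n := t)
    (by simpa using ht)
  exact ⟨_, by rw [← h.countP_mul_descFactorial hT, mul_comm]⟩

lemma IsTrivial.isDesign {B : Multiset (Finset X)} {t k : ℕ} (h : IsTrivial k B)
    (hB : ∀ b ∈ B, b.card = k) (htk : t ≤ k) : IsDesign t k B := by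
  obtain ⟨r, hr⟩ := h
  refine IsDesign.mono (t := k) ⟨le_rfl, hB, r, fun T hT => ?_⟩ htk
  rw [← hr T hT, Multiset.count]
  refine Multiset.countP_congr rfl fun b hb => ?_
  refine propext ⟨fun hTb => Finset.eq_of_subset_of_card_le hTb (by rw [hT, hB b hb]), ?_⟩
  rintro rfl
  exact subset_rfl

/-- Block intersection numbers: blocks avoiding a are all blocks less those containing a, by
induction on the number of avoided points. -/
lemma IsDesign.exists_countP_disjoint {B : Multiset (Finset X)} {t k : ℕ} (h : IsDesign t k B)
    (s : ℕ) : ∀ u, u + s ≤ t → ∃ c : ℤ, ∀ T S : Finset X, T.card = u → S.card = s →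
      Disjoint T S → ((B.countP fun b => T ⊆ b ∧ Disjoint S b : ℕ) : ℤ) = c := by
  induction s with
  | zero =>
    intro u hu
    obtain ⟨_, _, c, hc⟩ := h.mono (s := u) (by omega)
    refine ⟨c, fun T S hT hS _ => ?_⟩
    rw [Finset.card_eq_zero.1 hS]
    simp [hc T hT]
  | succ s ih =>
    intro u hu
    obtain ⟨c, hc⟩ := ih u (by omega)
    obtain ⟨c', hc'⟩ := ih (u + 1) (by omega)
    refine ⟨c - c', fun T S hT hS hd => ?_⟩
    obtain ⟨a, S, ha, rfl, hS'⟩ := Finset.card_eq_succ.1 hS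
    rw [Finset.disjoint_insert_right] at hd
    rw [← hc T S hT hS' hd.2, ← hc' (insert a T) S
      (by rw [Finset.card_insert_of_notMem hd.1, hT]) hS'
      (by rw [Finset.disjoint_insert_left]; exact ⟨ha, hd.2⟩), eq_sub_iff_add_eq]
    norm_cast
    clear hc hc' h hu ih
    induction B using Multiset.induction_on with
    | empty => simp
    | cons b B ih =>
      have hif : ((if T ⊆ b ∧ Disjoint (insert a S) b then 1 else 0) +
          if insert a T ⊆ b ∧ Disjoint S b then 1 else 0) =
          if T ⊆ b ∧ Disjoint S b then 1 else 0 := by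
        by_cases h1 : a ∈ b <;> by_cases h2 : T ⊆ b <;> by_cases h3 : Disjoint S b <;>
          simp [Finset.disjoint_insert_left, Finset.insert_subset_iff, h1, h2, h3]
      simp only [Multiset.countP_cons]
      rw [← ih, ← hif]
      ring

/-- The multiplicity of T is the number of blocks disjoint from its complement, a set of at most t
points. -/
lemma IsDesign.isTrivial {B : Multiset (Finset X)} {t k : ℕ} (h : IsDesign t k B)
    (hk : Fintype.card X ≤ k + t) : IsTrivial k B := by
  by_cases hkn : k ≤ Fintype.card X
  swap
  · exact ⟨0, fun T hT => (hkn (hT ▸ Finset.card_le_univ T)).elim⟩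
  obtain ⟨c, hc⟩ := h.exists_countP_disjoint (Fintype.card X - k) 0 (by omega)
  refine ⟨c.toNat, fun T hT => ?_⟩
  rw [← hc ∅ Tᶜ rfl (by rw [Finset.card_compl, hT]) (by simp), Int.toNat_natCast, Multiset.count]
  refine Multiset.countP_congr rfl fun b hb => ?_
  refine propext ⟨?_, ?_⟩
  · rintro rfl
    exact ⟨by simp, disjoint_compl_left⟩
  · rintro ⟨-, hd⟩
    refine (Finset.eq_of_subset_of_card_le ?_ (by rw [hT, h.2.1 b hb])).symm
    intro x hx
    by_contra hxT
    exact Finset.disjoint_left.1 hd (Finset.mem_compl.2 hxT) hx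

end Designs

end TernaryCode

/-! ### Harmonic weight enumerators and the MacWilliams identity. -/

namespace TernaryCode

section MacWilliams

open Polynomial

/-- The polynomial `P`, homogenized to degree `N`, is mapped to `κ P` by the MacWilliams
substitution `(x, y) ↦ (x + 2y, x - y)`. -/
def MacWilliamsInvariant (N : ℕ) (κ : ℂ) (P : ℂ[X]) : Prop :=
  ∀ y : ℂ, 1 + 2 * y ≠ 0 → (1 + 2 * y) ^ N * P.eval ((1 - y) / (1 + 2 * y)) = κ * P.eval y

/-- The Fourier transform on `𝔽₃`. -/
noncomputable def fourier (g : ZMod 3 → ℂ) (a : ZMod 3) : ℂ :=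
  ∑ b, ZMod.stdAddChar (a * b) * g b

lemma fourier_ite (α β : ℂ) (a : ZMod 3) :
    fourier (fun b => if b = 0 then α else β) a = if a = 0 then α + 2 * β else α - β := by
  have h : ∀ b : ZMod 3, (if b = 0 then α else β) = β + if b = 0 then α - β else 0 := by
    intro b; split_ifs <;> ring
  simp only [fourier, h, mul_add, Finset.sum_add_distrib, ← Finset.sum_mul, mul_ite, mul_zero,
    Finset.sum_ite_eq', Finset.mem_univ, if_true, AddChar.map_zero_eq_one, one_mul]
  have := AddChar.sum_mulShift a (ZMod.isPrimitive_stdAddChar 3)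
  simp only [mul_comm _ a] at this
  rw [this]
  split_ifs <;> simp
  ring

variable {n : ℕ} {C : LinearCode n}

open Classical in
/-- The set of codewords as a finset. -/
noncomputable def codewords (C : LinearCode n) : Finset (Fin n → ZMod 3) :=
  Finset.univ.filter fun x => x ∈ C

@[simp] lemma mem_codewords {x : Fin n → ZMod 3} : x ∈ codewords C ↔ x ∈ C := by
  simp [codewords]

@[simp] lemma mem_supp {x : Fin n → ZMod 3} {i : Fin n} : i ∈ supp x ↔ x i ≠ 0 := by
  simp [supp]

lemma card_supp (x : Fin n → ZMod 3) : (supp x).card = hammingNorm x := rfl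

lemma stdAddChar_sum (f : Fin n → ZMod 3) :
    (ZMod.stdAddChar (∑ j, f j) : ℂ) = ∏ j, ZMod.stdAddChar (f j) := by
  induction (Finset.univ : Finset (Fin n)) using Finset.induction_on with
  | empty => simp
  | insert a s ha ih =>
    rw [Finset.sum_insert ha, Finset.prod_insert ha, AddChar.map_add_eq_mul, ih]

/-- Orthogonality of characters: if u is not in the dual, translation by some codeword multiplies
the sum by a root of unity other than 1. -/
lemma sum_char_codewords (hC : C = dual C) (u : Fin n → ZMod 3) :
    ∑ v ∈ codewords C, ZMod.stdAddChar (∑ j, v j * u j) =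
      if u ∈ codewords C then ((codewords C).card : ℂ) else 0 := by
  by_cases hu : u ∈ codewords C
  · rw [if_pos hu, Finset.sum_congr rfl (g := fun _ => (1 : ℂ))]
    · simp
    intro v hv
    rw [mem_codewords] at hu hv
    rw [hC] at hu
    rw [hu v hv, AddChar.map_zero_eq_one]
  · rw [if_neg hu]
    have hu' : u ∉ dual C := by rw [← hC]; simpa using hu
    have : ∃ x ∈ C, ∑ i, x i * u i ≠ 0 := by
      by_contra! h
      exact hu' h
    obtain ⟨x, hx, hxu⟩ := this
    have h1 : ∑ v ∈ codewords C, (ZMod.stdAddChar (∑ j, v j * u j) : ℂ) =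
        ZMod.stdAddChar (∑ i, x i * u i) *
          ∑ v ∈ codewords C, ZMod.stdAddChar (∑ j, v j * u j) := by
      rw [Finset.mul_sum]
      symm
      refine Finset.sum_bij (fun v _ => x + v) ?_ ?_ ?_ ?_
      · intro v hv
        rw [mem_codewords] at hv ⊢
        exact C.add_mem hx hv
      · intro v _ w _ h
        exact add_left_cancel h
      · intro v hv
        rw [mem_codewords] at hv
        exact ⟨v - x, by rw [mem_codewords]; exact C.sub_mem hv hx, by simp⟩
      · intro v _
        rw [← AddChar.map_add_eq_mul, ← Finset.sum_add_distrib]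
        simp [add_mul]
    have h2 : (ZMod.stdAddChar (∑ i, x i * u i) : ℂ) ≠ 1 := by
      intro h
      rw [← AddChar.map_zero_eq_one (ZMod.stdAddChar (N := 3))] at h
      exact hxu (ZMod.injective_stdAddChar h)
    have h3 : (ZMod.stdAddChar (∑ i, x i * u i) - 1) *
        ∑ v ∈ codewords C, (ZMod.stdAddChar (∑ j, v j * u j) : ℂ) = 0 := by
      rw [sub_mul, ← h1, one_mul, sub_self]
    exact (mul_eq_zero.1 h3).resolve_left (sub_ne_zero.2 h2)

/-- Poisson summation over a self-dual code, for product functions. -/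
lemma sum_prod_fourier (hC : C = dual C) (g : Fin n → ZMod 3 → ℂ) :
    ∑ v ∈ codewords C, ∏ j, fourier (g j) (v j) =
      (codewords C).card * ∑ v ∈ codewords C, ∏ j, g j (v j) := by
  simp only [fourier, Finset.prod_univ_sum, Fintype.piFinset_univ, Finset.prod_mul_distrib]
  rw [Finset.sum_comm]
  have : ∀ u : Fin n → ZMod 3, ∑ v ∈ codewords C,
      (∏ j, ZMod.stdAddChar (v j * u j)) * ∏ j, g j (u j) =
      if u ∈ codewords C then (codewords C).card * ∏ j, g j (u j) else 0 := by
    intro u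
    simp only [← stdAddChar_sum, ← Finset.sum_mul, sum_char_codewords hC]
    split_ifs <;> simp
  rw [Finset.sum_congr rfl fun u _ => this u, ← Finset.sum_filter, Finset.mul_sum,
    Finset.filter_mem_eq_inter, Finset.univ_inter]

/-- For each pair the function 1[x ≠ 0] - 1[y ≠ 0] of two coordinates is an eigenfunction of the
Fourier transform with eigenvalue -3. -/
lemma sum_diffProd_fourier (hC : C = dual C) (l : List (Fin n × Fin n)) :
    ∀ g : Fin n → ZMod 3 → ℂ, (points l).Nodup →
      ∑ v ∈ codewords C, (-3) ^ l.length * (diffProd l (supp v) : ℂ) *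
          ∏ j ∈ (points l).toFinsetᶜ, fourier (g j) (v j) =
        (codewords C).card * ∑ v ∈ codewords C, (diffProd l (supp v) : ℂ) *
          ∏ j ∈ (points l).toFinsetᶜ, g j (v j) := by
  induction l with
  | nil =>
    intro g _
    simpa using sum_prod_fourier hC g
  | cons p l ih =>
    intro g hl
    obtain ⟨a, b⟩ := p
    simp only [points_cons, List.nodup_cons, List.mem_cons, not_or] at hl
    obtain ⟨⟨hab, hal⟩, hbl, hl⟩ := hl
    set Q : Finset (Fin n) := (points ((a, b) :: l)).toFinsetᶜ with hQ
    have haQ : a ∉ insert b Q := by simp [hQ, hab]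
    have hbQ : b ∉ Q := by simp [hQ]
    have hins : (points l).toFinsetᶜ = insert a (insert b Q) := by
      ext j
      simp only [hQ, points_cons, List.toFinset_cons, Finset.mem_compl, Finset.mem_insert,
        List.mem_toFinset, not_or]
      by_cases h1 : j = a
      · simp [h1, hal]
      by_cases h2 : j = b
      · simp [h2, hbl]
      simp [h1, h2]
    have hprod : ∀ (f : Fin n → (ZMod 3 → ℂ) → ℂ) (s t : ZMod 3 → ℂ),
        ∏ j ∈ (points l).toFinsetᶜ, f j (Function.update (Function.update g a s) b t j) =
          f a s * f b t * ∏ j ∈ Q, f j (g j) := by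
      intro f s t
      rw [hins, Finset.prod_insert haQ, Finset.prod_insert hbQ, Function.update_self,
        Function.update_of_ne hab, Function.update_self, mul_assoc]
      congr 2
      refine Finset.prod_congr rfl fun j hj => ?_
      rw [Function.update_of_ne (by rintro rfl; exact hbQ hj),
        Function.update_of_ne (by rintro rfl; exact haQ (Finset.mem_insert_of_mem hj))]
    -- The difference of two product functions: 1[x ≠ 0] at a and 1 at b, less the same with a and b
    -- exchanged. The constant 1 is written as a conditional so that `fourier_ite` applies to it.
    have key := congrArg₂ (· - ·)
      (ih (Function.update (Function.update g a fun x => if x = 0 then 0 else 1) b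
        fun x => if x = 0 then 1 else 1) hl)
      (ih (Function.update (Function.update g a fun x => if x = 0 then 1 else 1) b
        fun x => if x = 0 then 0 else 1) hl)
    simp only [fun v : Fin n → ZMod 3 => hprod (fun j s => s (v j)), fun v : Fin n → ZMod 3 =>
      hprod (fun j s => fourier s (v j)), ← mul_sub, ← Finset.sum_sub_distrib] at key
    convert key using 1
    · refine Finset.sum_congr rfl fun v _ => ?_
      simp only [fourier_ite, diffProd_cons, mem_supp, List.length_cons]
      by_cases h1 : v a = 0 <;> by_cases h2 : v b = 0 <;> simp only [h1, h2, if_true, if_false,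
        ne_eq, not_true, not_false_iff] <;> push_cast <;> ring
    · congr 1
      refine Finset.sum_congr rfl fun v _ => ?_
      simp only [diffProd_cons, mem_supp]
      by_cases h1 : v a = 0 <;> by_cases h2 : v b = 0 <;> simp only [h1, h2, if_true, if_false,
        ne_eq, not_true, not_false_iff] <;> push_cast <;> ring

/-- The enumerator of the codewords, weighted by `diffProd l`, divided by `Y ^ l.length`. -/
noncomputable def diffEnumerator (C : LinearCode n) (l : List (Fin n × Fin n)) : ℂ[X] :=
  ∑ v ∈ codewords C, monomial (hammingNorm v - l.length) (diffProd l (supp v) : ℂ)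

/-- Where the product is nonzero, the pairs account for exactly `l.length` of the weight; so the
exponent in `diffEnumerator` is the weight on the other n - 2k coordinates and is not truncated. -/
lemma card_filter_compl_points {l : List (Fin n × Fin n)} (hl : (points l).Nodup)
    {v : Fin n → ZMod 3} (h : diffProd l (supp v) ≠ 0) :
    ((points l).toFinsetᶜ.filter fun j => v j ≠ 0).card + l.length = hammingNorm v := by
  rw [← card_filter_points hl h, ← card_supp, ← Finset.card_sdiff_add_card_inter (supp v)
    (points l).toFinset]
  congr 2
  ext j
  simp [and_comm]

lemma length_points (l : List (Fin n × Fin n)) : (points l).length = 2 * l.length := by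
  induction l with
  | nil => rfl
  | cons p l ih => simp [ih]; ring

lemma two_mul_length_le {l : List (Fin n × Fin n)} (hl : (points l).Nodup) : 2 * l.length ≤ n := by
  rw [← length_points]
  simpa using hl.length_le_card

lemma prod_ite_eq (s : Finset (Fin n)) (v : Fin n → ZMod 3) (α β : ℂ) :
    ∏ j ∈ s, (if v j = 0 then α else β) =
      α ^ (s.card - (s.filter fun j => v j ≠ 0).card) * β ^ (s.filter fun j => v j ≠ 0).card := by
  rw [Finset.prod_ite, Finset.prod_const, Finset.prod_const]
  congr 2
  have := Finset.card_filter_add_card_filter_not (s := s) (fun j => v j = 0)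
  simp only [ne_eq]
  omega

lemma diffEnumerator_invariant (hC : C = dual C) {l : List (Fin n × Fin n)}
    (hl : (points l).Nodup) :
    MacWilliamsInvariant (n - 2 * l.length) ((codewords C).card / (-3) ^ l.length)
      (diffEnumerator C l) := by
  intro y hy
  have h := sum_diffProd_fourier hC l (fun _ b => if b = 0 then 1 else y) hl
  simp only [fourier_ite, prod_ite_eq] at h
  have hcard : (points l).toFinsetᶜ.card = n - 2 * l.length := by
    rw [Finset.card_compl, List.toFinset_card_of_nodup hl, length_points, Fintype.card_fin]
  have h3 : ((-3 : ℂ)) ^ l.length ≠ 0 := pow_ne_zero _ (by norm_num)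
  rw [div_mul_eq_mul_div, eq_div_iff h3]
  simp only [diffEnumerator, eval_finsetSum, eval_monomial]
  convert h using 1
  · rw [Finset.mul_sum, Finset.sum_mul]
    refine Finset.sum_congr rfl fun v _ => ?_
    by_cases h0 : diffProd l (supp v) = 0
    · simp [h0]
    have hw := card_filter_compl_points hl h0
    have hle := Finset.card_filter_le (points l).toFinsetᶜ fun j => v j ≠ 0
    rw [show hammingNorm v - l.length = ((points l).toFinsetᶜ.filter fun j => v j ≠ 0).card by
      omega]
    rw [hcard] at hle ⊢
    clear hw
    generalize ((points l).toFinsetᶜ.filter fun j => v j ≠ 0).card = c at hle ⊢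
    obtain ⟨e, he⟩ := Nat.exists_eq_add_of_le hle
    rw [he, Nat.add_sub_cancel_left, pow_add, div_pow]
    have hc : (1 + 2 * y) ^ c ≠ 0 := pow_ne_zero _ hy
    field_simp
  · congr 1
    refine Finset.sum_congr rfl fun v _ => ?_
    by_cases h0 : diffProd l (supp v) = 0
    · simp [h0]
    have hw := card_filter_compl_points hl h0
    rw [show hammingNorm v - l.length = ((points l).toFinsetᶜ.filter fun j => v j ≠ 0).card by
      omega, one_pow, one_mul]

lemma diffEnumerator_natDegree_le {l : List (Fin n × Fin n)} (hl : (points l).Nodup) :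
    (diffEnumerator C l).natDegree ≤ n - 2 * l.length := by
  refine natDegree_sum_le_of_forall_le _ _ fun v _ => ?_
  by_cases h0 : diffProd l (supp v) = 0
  · simp [h0]
  refine (natDegree_monomial_le _).trans ?_
  have hw := card_filter_compl_points hl h0
  have hle := Finset.card_filter_le (points l).toFinsetᶜ fun j => v j ≠ 0
  rw [Finset.card_compl, List.toFinset_card_of_nodup hl, length_points, Fintype.card_fin] at hle
  omega

lemma diffSum_supportDesign (C : LinearCode n) (l : List (Fin n × Fin n)) (w : ℕ) :
    diffSum l (supportDesign C w) =
      ∑ v ∈ (codewords C).filter (fun v => hammingNorm v = w), diffProd l (supp v) := by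
  classical
  rw [diffSum, supportDesign, Multiset.map_map, codewords, Finset.filter_filter]
  rfl

lemma diffEnumerator_coeff (C : LinearCode n) {l : List (Fin n × Fin n)} (hl : (points l).Nodup)
    (i : ℕ) : (diffEnumerator C l).coeff i = diffSum l (supportDesign C (i + l.length)) := by
  rw [diffSum_supportDesign, diffEnumerator, finsetSum_coeff, Finset.sum_filter]
  push_cast
  refine Finset.sum_congr rfl fun v _ => ?_
  rw [coeff_monomial]
  by_cases h0 : diffProd l (supp v) = 0
  · simp [h0]
  have hw := card_filter_compl_points hl h0
  refine if_congr ?_ rfl rfl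
  omega

lemma card_supportDesign (C : LinearCode n) (w : ℕ) :
    diffSum [] (supportDesign C w) = (supportDesign C w).card := by
  simp [diffSum, _root_.funext diffProd_nil]

lemma card_of_mem_supportDesign {w : ℕ} {b : Finset (Fin n)} (hb : b ∈ supportDesign C w) :
    b.card = w := by
  rw [supportDesign, Multiset.mem_map] at hb
  obtain ⟨x, hx, rfl⟩ := hb
  simp only [Finset.mem_val, Finset.mem_filter] at hx
  rw [card_supp, hx.2.2]

lemma supportDesign_ne_zero {w : ℕ} :
    supportDesign C w ≠ 0 ↔ ∃ x ∈ C, hammingNorm x = w := by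
  classical
  rw [← Multiset.card_pos, supportDesign, Multiset.card_map, Finset.card_val, Finset.card_pos]
  simp [Finset.Nonempty]

end MacWilliams

end TernaryCode

/-! ### Structure of the invariants and their small degrees. -/

namespace TernaryCode

section Invariants

open Polynomial

lemma eq_of_eval_eq {P Q : ℂ[X]} (h : ∀ y : ℂ, 1 + 2 * y ≠ 0 → P.eval y = Q.eval y) : P = Q := by
  have h1 : (1 + 2 * X : ℂ[X]) * (P - Q) = 0 := by
    refine Polynomial.funext fun y => ?_
    by_cases hy : 1 + 2 * y = 0
    · simp [hy]
    · simp [h y hy]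
  have h2 : (1 + 2 * X : ℂ[X]) ≠ 0 := by
    intro h0
    simpa using congrArg (eval 0) h0
  exact sub_eq_zero.1 ((mul_eq_zero.1 h1).resolve_left h2)

lemma exists_substitution {S : ℂ[X]} {K : ℕ} (h : S.natDegree ≤ K) :
    ∃ T : ℂ[X], ∀ y : ℂ, 1 + 2 * y ≠ 0 →
      (1 + 2 * y) ^ K * S.eval ((1 - y) / (1 + 2 * y)) = T.eval y := by
  refine ⟨∑ i ∈ Finset.range (K + 1), C (S.coeff i) * (1 - X) ^ i * (1 + 2 * X) ^ (K - i),
    fun y hy => ?_⟩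
  rw [eval_eq_sum_range' (Nat.lt_succ_of_le h), eval_finsetSum, Finset.mul_sum]
  refine Finset.sum_congr rfl fun i hi => ?_
  obtain ⟨e, rfl⟩ := Nat.exists_eq_add_of_le (Nat.lt_succ_iff.1 (Finset.mem_range.1 hi))
  have hc : (1 + 2 * y) ^ i ≠ 0 := pow_ne_zero _ hy
  simp only [Nat.add_sub_cancel_left, eval_mul, eval_C, eval_pow, eval_sub, eval_one, eval_X,
    eval_add, eval_ofNat, div_pow, pow_add]
  field_simp

/-- X³ - 1 = (X - 1)(X² + X + 1), and the second factor does not vanish at 1, so R(X³) and R have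
the same order of vanishing at 1. -/
lemma pow_dvd_of_pow_dvd_expand {R : ℂ[X]} {d : ℕ} (h : (X - 1) ^ d ∣ expand ℂ 3 R) :
    (X - 1) ^ d ∣ R := by
  by_cases hR : R = 0
  · simp [hR]
  obtain ⟨S, hS, hS1⟩ := exists_eq_pow_rootMultiplicity_mul_and_not_dvd R hR 1
  rw [dvd_iff_isRoot, IsRoot.def] at hS1
  rw [map_one] at hS
  generalize rootMultiplicity 1 R = j at hS
  by_cases hdj : d ≤ j
  · rw [hS]
    exact Dvd.dvd.mul_right (pow_dvd_pow _ hdj) _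
  exfalso
  obtain ⟨e, rfl⟩ := Nat.exists_eq_add_of_lt (not_le.1 hdj)
  have hexp : expand ℂ 3 R = (X - 1) ^ j * ((X ^ 2 + X + 1) ^ j * expand ℂ 3 S) := by
    rw [hS, map_mul, map_pow, map_sub, expand_X, map_one, ← mul_assoc, ← mul_pow]
    congr 2
    ring
  rw [hexp, show j + e + 1 = j + (e + 1) by ring, pow_add,
    mul_dvd_mul_iff_left (pow_ne_zero _ (by simpa using X_sub_C_ne_zero (1 : ℂ)))] at h
  obtain ⟨T, hT⟩ := h
  have := congrArg (eval 1) hT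
  simp only [eval_mul, eval_pow, eval_add, eval_X, eval_one, expand_eval, eval_sub, sub_self,
    one_pow, zero_pow (Nat.succ_ne_zero e), zero_mul, mul_eq_zero] at this
  rcases this with h | h
  · exact pow_ne_zero j (by norm_num) h
  · exact hS1 h

lemma eq_X_pow_mul_expand {P : ℂ[X]} {d : ℕ} (h : ∀ i, P.coeff i ≠ 0 → d ≤ i ∧ 3 ∣ i - d) :
    ∃ R : ℂ[X], P = X ^ d * expand ℂ 3 R := by
  obtain ⟨S, rfl⟩ : X ^ d ∣ P := by
    rw [X_pow_dvd_iff]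
    intro i hi
    by_contra h0
    exact absurd (h i h0).1 (by omega)
  refine ⟨contract 3 S, ?_⟩
  congr 1
  ext i
  rw [coeff_expand (by norm_num), coeff_contract (by norm_num)]
  split_ifs with h3
  · rw [Nat.div_mul_cancel h3]
  · by_contra h0
    have := (h (i + d) (by rwa [coeff_X_pow_mul])).2
    rw [Nat.add_sub_cancel] at this
    exact h3 this

/-- The substitution turns the factor Y ^ d into (1 - Y) ^ d, which is coprime to Y ^ d and hence
divides R(Y³). -/
lemma one_sub_pow_dvd {R : ℂ[X]} {d N : ℕ} {κ : ℂ} (hκ : κ ≠ 0) (hN : d + 3 * R.natDegree ≤ N)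
    (h : MacWilliamsInvariant N κ (X ^ d * expand ℂ 3 R)) : (1 - X) ^ d ∣ R := by
  obtain ⟨K, rfl⟩ := Nat.exists_eq_add_of_le (show d ≤ N by omega)
  obtain ⟨T, hT⟩ := exists_substitution (S := expand ℂ 3 R) (K := K)
    (by rw [natDegree_expand]; omega)
  have heq : (1 - X) ^ d * T = C κ * (X ^ d * expand ℂ 3 R) := by
    refine eq_of_eval_eq fun y hy => ?_
    have := h y hy
    simp only [eval_mul, eval_pow, eval_X, eval_C, eval_sub, eval_one] at this ⊢
    have hc : (1 - y) ^ d = (1 + 2 * y) ^ d * ((1 - y) / (1 + 2 * y)) ^ d := by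
      rw [← mul_pow, mul_div_cancel₀ _ hy]
    rw [← this, ← hT y hy, pow_add, hc]
    ring
  have hco : IsCoprime ((1 - X : ℂ[X]) ^ d) (X ^ d) :=
    IsCoprime.pow ⟨1, 1, by ring⟩
  have hdvd : (1 - X) ^ d ∣ expand ℂ 3 R := by
    refine hco.dvd_of_dvd_mul_left ?_
    refine ((isUnit_C.2 (isUnit_iff_ne_zero.2 hκ)).dvd_mul_left).1 ⟨T, heq.symm⟩
  have hass : Associated ((1 - X : ℂ[X]) ^ d) ((X - 1) ^ d) := by
    refine Associated.pow_pow ?_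
    rw [← neg_sub X 1]
    exact Associated.neg_left (Associated.refl _)
  exact hass.dvd_iff_dvd_left.2 (pow_dvd_of_pow_dvd_expand (hass.dvd_iff_dvd_left.1 hdvd))

/-- The form y (x³ - y³) is itself invariant of degree 4, with factor 9, and can be cancelled. -/
lemma MacWilliamsInvariant.of_mul {N d : ℕ} {κ : ℂ} {Q : ℂ[X]}
    (hN : 4 * d + 3 * Q.natDegree ≤ N)
    (h : MacWilliamsInvariant N κ (X ^ d * expand ℂ 3 ((1 - X) ^ d * Q))) :
    MacWilliamsInvariant (N - 4 * d) (κ / 9 ^ d) (expand ℂ 3 Q) := by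
  obtain ⟨K, rfl⟩ := Nat.exists_eq_add_of_le (show 4 * d ≤ N by omega)
  obtain ⟨T, hT⟩ := exists_substitution (S := expand ℂ 3 Q) (K := K)
    (by rw [natDegree_expand]; omega)
  have h9 : (9 : ℂ) ^ d ≠ 0 := pow_ne_zero _ (by norm_num)
  have hX : (X * (1 - X ^ 3) : ℂ[X]) ^ d ≠ 0 := by
    refine pow_ne_zero _ (mul_ne_zero X_ne_zero fun h0 => ?_)
    simpa using congrArg (eval 0) h0
  have heq : (X * (1 - X ^ 3)) ^ d * (C (9 ^ d) * T) =
      (X * (1 - X ^ 3)) ^ d * (C κ * expand ℂ 3 Q) := by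
    refine eq_of_eval_eq fun y hy => ?_
    have := h y hy
    simp only [eval_mul, eval_pow, eval_X, expand_eval, eval_sub, eval_one, eval_C, pow_add,
      pow_mul] at this ⊢
    have hq : (9 : ℂ) ^ d * (y * (1 - y ^ 3)) ^ d = ((1 + 2 * y) ^ 4) ^ d *
        ((1 - y) / (1 + 2 * y)) ^ d * (1 - ((1 - y) / (1 + 2 * y)) ^ 3) ^ d := by
      rw [← mul_pow, ← mul_pow, ← mul_pow]
      congr 1
      have hu : (1 + 2 * y) * ((1 - y) / (1 + 2 * y)) = 1 - y := mul_div_cancel₀ _ hy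
      generalize (1 - y) / (1 + 2 * y) = u at hu
      calc 9 * (y * (1 - y ^ 3)) = (1 - y) * ((1 + 2 * y) ^ 3 - (1 - y) ^ 3) := by ring
        _ = (1 + 2 * y) ^ 4 * u * (1 - u ^ 3) := by rw [← hu]; ring
    have hT' := hT y hy
    simp only [expand_eval] at hT'
    rw [← hT']
    linear_combination this + (1 + 2 * y) ^ K * eval (((1 - y) / (1 + 2 * y)) ^ 3) Q * hq -
      κ * eval (y ^ 3) Q * (mul_pow y (1 - y ^ 3) d)
  rw [Nat.add_sub_cancel_left]
  intro y hy
  rw [hT y hy, div_mul_eq_mul_div, eq_div_iff h9, mul_comm]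
  simpa using congrArg (eval y) (mul_left_cancel₀ hX heq)

theorem exists_eq_pow_mul_expand {P : ℂ[X]} {N d : ℕ} {κ : ℂ} (hκ : κ ≠ 0)
    (hdeg : P.natDegree ≤ N) (hinv : MacWilliamsInvariant N κ P)
    (hsupp : ∀ i, P.coeff i ≠ 0 → d ≤ i ∧ 3 ∣ i - d) (hP : P ≠ 0) :
    ∃ Q : ℂ[X], P = X ^ d * expand ℂ 3 ((1 - X) ^ d * Q) ∧ 4 * d + 3 * Q.natDegree ≤ N ∧
      MacWilliamsInvariant (N - 4 * d) (κ / 9 ^ d) (expand ℂ 3 Q) := by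
  obtain ⟨R, rfl⟩ := eq_X_pow_mul_expand hsupp
  have hR : expand ℂ 3 R ≠ 0 := right_ne_zero_of_mul hP
  rw [natDegree_mul (pow_ne_zero _ X_ne_zero) hR, natDegree_X_pow, natDegree_expand] at hdeg
  obtain ⟨Q, rfl⟩ := one_sub_pow_dvd hκ (by omega) hinv
  have hQ : (1 - X) ^ d * Q ≠ 0 := by
    rintro h0
    simp [h0] at hR
  have h1 : (1 - X : ℂ[X]).natDegree = 1 := by
    rw [← neg_sub X 1, natDegree_neg]
    exact natDegree_X_sub_C (1 : ℂ)
  rw [natDegree_mul (left_ne_zero_of_mul hQ) (right_ne_zero_of_mul hQ), natDegree_pow, h1] at hdeg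
  refine ⟨Q, rfl, by omega, hinv.of_mul (by omega)⟩

lemma eq_C_of_invariant_zero {Q : ℂ[X]} (hQ : 3 * Q.natDegree ≤ 2) : ∃ c, Q = C c :=
  ⟨_, eq_C_of_natDegree_eq_zero (by omega)⟩

lemma eq_zero_of_invariant_two {Q : ℂ[X]} {κ : ℂ} (hQ : 3 * Q.natDegree ≤ 2)
    (h : MacWilliamsInvariant 2 κ (expand ℂ 3 Q)) : Q = 0 := by
  obtain ⟨c, rfl⟩ := eq_C_of_invariant_zero hQ
  have h0 := h 0 (by norm_num)
  have h1 := h 1 (by norm_num)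
  simp only [expand_C, eval_C] at h0 h1
  rw [show c = 0 by linear_combination (h1 - h0) / 8, C_0]

lemma eq_of_invariant_four {Q : ℂ[X]} {κ : ℂ} (hQ : 3 * Q.natDegree ≤ 4)
    (h : MacWilliamsInvariant 4 κ (expand ℂ 3 Q)) : ∃ c, Q = C c * (1 + 8 * X) := by
  have hQ1 : Q.natDegree ≤ 1 := by omega
  rw [natDegree_le_iff_coeff_eq_zero] at hQ1
  obtain ⟨a, b, rfl⟩ : ∃ a b, Q = C a + C b * X := by
    refine ⟨Q.coeff 0, Q.coeff 1, ?_⟩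
    ext (_ | _ | i)
    · simp
    · simp [coeff_C]
    · rw [hQ1 _ (by omega)]
      simp
  have e1 := h 1 (by norm_num)
  have e1' := h (-1) (by norm_num)
  have e2 := h 2 (by norm_num)
  have e2' := h (-2) (by norm_num)
  simp only [expand_eval, eval_add, eval_C, eval_mul, eval_X] at e1 e1' e2 e2'
  norm_num at e1 e1' e2 e2'
  have : b = 8 * a := by linear_combination -(8 * (e1 - e1') - (e2 - e2')) / 12
  refine ⟨a, ?_⟩
  rw [this]
  simp only [map_mul, C_ofNat]
  ring

lemma eq_of_invariant_six {Q : ℂ[X]} {κ : ℂ} (hQ : 3 * Q.natDegree ≤ 6)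
    (h : MacWilliamsInvariant 6 κ (expand ℂ 3 Q)) :
    ∃ c, Q = C c * (1 - 20 * X - 8 * X ^ 2) := by
  have hQ1 : Q.natDegree ≤ 2 := by omega
  rw [natDegree_le_iff_coeff_eq_zero] at hQ1
  obtain ⟨a, b, c, rfl⟩ : ∃ a b c, Q = C a + C b * X + C c * X ^ 2 := by
    refine ⟨Q.coeff 0, Q.coeff 1, Q.coeff 2, ?_⟩
    ext (_ | _ | _ | i)
    · simp
    · simp [coeff_C, coeff_X_pow]
    · simp
    · rw [hQ1 _ (by omega)]
      simp
  have e0 := h 0 (by norm_num)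
  have e1 := h 1 (by norm_num)
  have e1' := h (-1) (by norm_num)
  have e2 := h 2 (by norm_num)
  have e2' := h (-2) (by norm_num)
  have e3 := h 3 (by norm_num)
  have e3' := h (-3) (by norm_num)
  simp only [expand_eval, eval_add, eval_C, eval_mul, eval_X, eval_pow] at e0 e1 e1' e2 e2' e3 e3'
  norm_num at e0 e1 e1' e2 e2' e3 e3'
  -- As in degree 4: finite differences, exact up to degree 6, isolate the coefficients of y (`h1`)
  -- and y² (`h2`), which are absent on the right side.
  have h1 : 12 * a + 3 * b - 6 * c = 0 := by
    linear_combination (45 * (e1 - e1') - 9 * (e2 - e2') + (e3 - e3')) / 60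
  have h2 : 60 * a - 3 * b + 15 * c = 0 := by
    linear_combination (270 * (e1 + e1') - 27 * (e2 + e2') + 2 * (e3 + e3') - 490 * e0) / 360
  have hc : c = -8 * a := by linear_combination (h1 + h2) / 9
  have hb : b = -20 * a := by linear_combination h1 / 3 + 2 * hc
  refine ⟨a, ?_⟩
  rw [hb, hc]
  simp only [map_mul, map_neg, C_ofNat]
  ring

end Invariants

end TernaryCode

/-! ### Obstructions to design strength in extremal codes. -/

namespace TernaryCode

section Extremal

open Polynomial

variable {n m r : ℕ} {C : LinearCode n}

/-- All sums `∑ diffProd l` of degree `1, …, t` over the blocks of each `D_w` vanish. -/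
def DiffSumsVanish (C : LinearCode n) (t : ℕ) : Prop :=
  ∀ l : List (Fin n × Fin n), (points l).Nodup → l ≠ [] → l.length ≤ t →
    ∀ w, diffSum l (supportDesign C w) = 0

lemma IsExtremalTypeIII.exists_weight (hC : IsExtremalTypeIII C) (hn : n / 12 = m)
    {x : Fin n → ZMod 3} (hx : x ∈ C) (hx0 : x ≠ 0) : ∃ j, hammingNorm x = 3 * m + 3 + 3 * j := by
  have h1 := hC.2.2 ⟨x, hx, hx0, rfl⟩
  obtain ⟨c, hc⟩ := hC.1.2 x hx
  rw [hn] at h1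
  exact ⟨c - (m + 1), by omega⟩

lemma IsExtremalTypeIII.exists_of_ne_zero (hC : IsExtremalTypeIII C) (hn : n / 12 = m) {w : ℕ}
    (hw0 : w ≠ 0) (hw : supportDesign C w ≠ 0) : ∃ j, w = 3 * m + 3 + 3 * j := by
  obtain ⟨x, hx, rfl⟩ := supportDesign_ne_zero.1 hw
  exact hC.exists_weight hn hx (by rintro rfl; simp at hw0)

lemma diffProd_empty {X : Type*} [DecidableEq X] {l : List (X × X)} (hl : l ≠ []) :
    diffProd l ∅ = 0 := by
  cases l with
  | nil => exact (hl rfl).elim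
  | cons p l => simp [diffProd_cons]

lemma IsExtremalTypeIII.exists_of_diffSum_ne_zero (hC : IsExtremalTypeIII C) (hn : n / 12 = m)
    {l : List (Fin n × Fin n)} (hne : l ≠ []) {w : ℕ} (hw : diffSum l (supportDesign C w) ≠ 0) :
    ∃ j, w = 3 * m + 3 + 3 * j := by
  refine hC.exists_of_ne_zero hn ?_ ?_
  · rintro rfl
    refine hw ?_
    rw [diffSum_supportDesign]
    refine Finset.sum_eq_zero fun v hv => ?_
    have : v = 0 := by simpa using (Finset.mem_filter.1 hv).2
    rw [this, show supp (0 : Fin n → ZMod 3) = ∅ by ext; simp, diffProd_empty hne]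
  · intro h
    simp [h, diffSum] at hw

lemma IsExtremalTypeIII.supportDesign_min_ne_zero (hC : IsExtremalTypeIII C) (hn : n / 12 = m) :
    supportDesign C (3 * m + 3) ≠ 0 := by
  obtain ⟨x, hx, -, hw⟩ := hC.2.1
  exact supportDesign_ne_zero.2 ⟨x, hx, by rw [hw, hn]⟩

lemma DiffSumsVanish.isDesign {t : ℕ} (h : DiffSumsVanish C t) {w : ℕ} (ht : t ≤ w) :
    IsDesign t w (supportDesign C w) :=
  isDesign_of_diffSum_eq_zero ht (fun _ => card_of_mem_supportDesign)
    fun l hl hne hle => h l hl hne hle w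

lemma IsTrivial.supportDesign_isDesign {t w : ℕ} (h : IsTrivial w (supportDesign C w))
    (ht : t ≤ w) : IsDesign t w (supportDesign C w) :=
  h.isDesign (fun _ => card_of_mem_supportDesign) ht

/-- An obstruction of degree `t + 1` in the minimum weight shows that `δ = t`. -/
theorem IsExtremalTypeIII.delta_eq (hC : IsExtremalTypeIII C) (hn : n / 12 = m) {t : ℕ}
    (htD : t ≤ 3 * m + 3) (hvan : DiffSumsVanish C t) {l : List (Fin n × Fin n)}
    (hl : (points l).Nodup) (hlen : l.length = t + 1)
    (hne : diffSum l (supportDesign C (3 * m + 3)) ≠ 0) : delta C = t := by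
  have hl0 : l ≠ [] := by rintro rfl; simp at hlen
  refine IsGreatest.csSup_eq ⟨?_, ?_⟩
  · intro w hw0 hw
    obtain ⟨j, rfl⟩ := hC.exists_of_ne_zero hn hw0 hw
    exact hvan.isDesign (by omega)
  · intro u hu
    by_contra! h
    exact hne ((hu _ (by omega) (hC.supportDesign_min_ne_zero hn)).diffSum_eq_zero hl0 hl
      (by omega))

/-- A nontrivial `D_w` on which a sum of degree `k` does not vanish is not a design of strength
`k` or more. -/
lemma IsExtremalTypeIII.lt_of_isDesign (hC : IsExtremalTypeIII C) (hn : n / 12 = m) {k w u : ℕ}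
    {l : List (Fin n × Fin n)} (hl0 : l ≠ []) (hl : (points l).Nodup) (hlen : l.length = k)
    (hne : ∀ j, w = 3 * m + 3 + 3 * j → w + k ≤ n → diffSum l (supportDesign C w) ≠ 0)
    (hw0 : w ≠ 0) (hnt : ¬ IsTrivial w (supportDesign C w))
    (hdes : IsDesign u w (supportDesign C w)) : u < k := by
  by_contra! h
  by_cases hw : supportDesign C w = 0
  · exact hnt ⟨0, by simp [hw]⟩
  obtain ⟨j, hj⟩ := hC.exists_of_ne_zero hn hw0 hw
  by_cases hle : w + k ≤ n
  · exact hne j hj hle (hdes.diffSum_eq_zero hl0 hl (by omega))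
  -- Here n - w < k ≤ u, and strength at least n - w makes the design trivial.
  · exact hnt (hdes.isTrivial (by rw [Fintype.card_fin]; omega))

/-- An obstruction of degree `t + 1` in every weight up to `n - (t + 1)` shows that `δ = s = t`. -/
theorem IsExtremalTypeIII.delta_eq_and_s_eq (hC : IsExtremalTypeIII C) (hn : n / 12 = m) {t : ℕ}
    (htD : t + 1 ≤ 3 * m + 3) (htn : 3 * m + 3 + (t + 1) ≤ n) (hvan : DiffSumsVanish C t)
    {l : List (Fin n × Fin n)} (hl : (points l).Nodup) (hlen : l.length = t + 1)
    (hne : ∀ j, 3 * m + 3 + 3 * j + (t + 1) ≤ n →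
      diffSum l (supportDesign C (3 * m + 3 + 3 * j)) ≠ 0) :
    delta C = t ∧ s C = t := by
  have hl0 : l ≠ [] := by rintro rfl; simp at hlen
  have hDne : diffSum l (supportDesign C (3 * m + 3)) ≠ 0 := hne 0 htn
  refine ⟨hC.delta_eq hn (by omega) hvan hl hlen hDne, IsGreatest.csSup_eq ⟨?_, ?_⟩⟩
  · refine ⟨3 * m + 3, by omega, fun h => ?_, hvan.isDesign (by omega)⟩
    exact hDne ((h.supportDesign_isDesign htD).diffSum_eq_zero hl0 hl (by omega))
  · rintro u ⟨w, hw0, hnt, hdes⟩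
    refine Nat.lt_succ_iff.1 (hC.lt_of_isDesign hn hl0 hl hlen ?_ hw0 hnt hdes)
    rintro j rfl hle
    exact hne j hle

lemma DiffSumsVanish.descFactorial_dvd {t w : ℕ} (h : DiffSumsVanish C t) (ht : t ≤ w)
    (htn : t ≤ n) : n.descFactorial t ∣ (supportDesign C w).card * w.descFactorial t := by
  simpa using (h.isDesign ht).descFactorial_dvd (by simpa using htn)

lemma DiffSumsVanish.succ {t : ℕ} (h : DiffSumsVanish C t)
    (h' : ∀ l : List (Fin n × Fin n), (points l).Nodup → l.length = t + 1 →
      ∀ w, diffSum l (supportDesign C w) = 0) : DiffSumsVanish C (t + 1) := by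
  intro l hl hne hle
  rcases Nat.lt_or_eq_of_le hle with hlt | heq
  · exact h l hl hne (by omega)
  · exact h' l hl heq

lemma card_codewords_ne_zero : ((codewords C).card : ℂ) ≠ 0 := by
  have : (0 : Fin n → ZMod 3) ∈ codewords C := by simp
  exact_mod_cast Finset.card_ne_zero_of_mem this

/-- Shape of the weighted enumerators: up to the factor `(Y (1 - Y³)) ^ d` they are invariants of
degree `2 k + 4 r - 12`. -/
theorem IsExtremalTypeIII.diffEnumerator_eq (hC : IsExtremalTypeIII C) (hn : n = 12 * m + 4 * r)
    (hr : r ≤ 2) {l : List (Fin n × Fin n)} (hl : (points l).Nodup) (hne : l ≠ [])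
    (hlD : l.length ≤ 3 * m + 3) :
    diffEnumerator C l = 0 ∨ ∃ (Q : ℂ[X]) (κ : ℂ),
      (∀ j, (diffSum l (supportDesign C (3 * m + 3 + 3 * j)) : ℂ) =
        ((1 - X) ^ (3 * m + 3 - l.length) * Q).coeff j) ∧
      12 + 3 * Q.natDegree ≤ 2 * l.length + 4 * r ∧
      MacWilliamsInvariant (2 * l.length + 4 * r - 12) κ (expand ℂ 3 Q) := by
  have hn12 : n / 12 = m := by omega
  refine or_iff_not_imp_left.2 fun hP => ?_
  have h2 := two_mul_length_le hl
  obtain ⟨Q, hQ, hdeg, hinv⟩ := exists_eq_pow_mul_expand (d := 3 * m + 3 - l.length)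
    (div_ne_zero card_codewords_ne_zero (pow_ne_zero _ (by norm_num)))
    (diffEnumerator_natDegree_le (C := C) hl) (diffEnumerator_invariant hC.1.1 hl)
    (by
      intro i hi
      rw [diffEnumerator_coeff C hl] at hi
      obtain ⟨j, hj⟩ := hC.exists_of_diffSum_ne_zero hn12 hne (by exact_mod_cast hi)
      exact ⟨by omega, j, by omega⟩) hP
  refine ⟨Q, (codewords C).card / (-3) ^ l.length / 9 ^ (3 * m + 3 - l.length), fun j => ?_,
    by omega, ?_⟩
  · have h := diffEnumerator_coeff C hl (3 * m + 3 - l.length + 3 * j)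
    rw [hQ, add_comm _ (3 * j), coeff_X_pow_mul, mul_comm 3 j, coeff_expand_mul (by norm_num),
      show j * 3 + (3 * m + 3 - l.length) + l.length = 3 * m + 3 + 3 * j by omega] at h
    exact h.symm
  · convert hinv using 1
    omega

lemma IsExtremalTypeIII.diffSum_eq_zero_of_forall (hC : IsExtremalTypeIII C) (hn : n / 12 = m)
    {l : List (Fin n × Fin n)} (hne : l ≠ [])
    (h : ∀ j, diffSum l (supportDesign C (3 * m + 3 + 3 * j)) = 0) (w : ℕ) :
    diffSum l (supportDesign C w) = 0 := by
  by_contra h0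
  obtain ⟨j, rfl⟩ := hC.exists_of_diffSum_ne_zero hn hne h0
  exact h0 (h j)

lemma diffSum_eq_zero_of_diffEnumerator {l : List (Fin n × Fin n)} (hl : (points l).Nodup)
    (h : diffEnumerator C l = 0) (w : ℕ) : diffSum l (supportDesign C w) = 0 := by
  by_cases hw : l.length ≤ w
  · have := diffEnumerator_coeff C hl (w - l.length)
    rw [h, coeff_zero, Nat.sub_add_cancel hw] at this
    exact_mod_cast this.symm
  · rw [diffSum_supportDesign]
    refine Finset.sum_eq_zero fun v hv => ?_
    by_contra h0
    have := card_filter_compl_points hl h0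
    rw [(Finset.mem_filter.1 hv).2] at this
    omega

/-- The invariant Q would have negative degree in the first case and degree 2 in the second. -/
lemma IsExtremalTypeIII.diffSum_eq_zero (hC : IsExtremalTypeIII C) (hn : n = 12 * m + 4 * r)
    (hr : r ≤ 2) {l : List (Fin n × Fin n)} (hl : (points l).Nodup) (hne : l ≠ [])
    (hlD : l.length ≤ 3 * m + 3) (h : l.length + 2 * r < 6 ∨ l.length + 2 * r = 7) (w : ℕ) :
    diffSum l (supportDesign C w) = 0 := by
  rcases hC.diffEnumerator_eq hn hr hl hne hlD with h0 | ⟨Q, κ, hQ, hdeg, hinv⟩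
  · exact diffSum_eq_zero_of_diffEnumerator hl h0 w
  refine hC.diffSum_eq_zero_of_forall (m := m) (by omega) hne (fun j => ?_) w
  rcases h with h | h
  · omega
  · rw [show 2 * l.length + 4 * r - 12 = 2 by omega] at hinv
    have := hQ j
    rw [eq_zero_of_invariant_two (by omega) hinv, mul_zero, coeff_zero] at this
    exact_mod_cast this

lemma coeff_one_sub_pow (d j : ℕ) :
    ((1 - X : ℂ[X]) ^ d).coeff j = (-1) ^ j * (d.choose j : ℂ) := by
  rw [sub_eq_add_neg, add_comm, add_pow, finsetSum_coeff]
  simp only [one_pow, mul_one, neg_pow (X : ℂ[X])]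
  have : ∀ i, ((-1 : ℂ[X]) ^ i * X ^ i * (d.choose i : ℂ[X])).coeff j =
      if j = i then (-1) ^ i * (d.choose i : ℂ) else 0 := by
    intro i
    rw [show (-1 : ℂ[X]) ^ i * X ^ i * (d.choose i : ℂ[X]) =
      C ((-1) ^ i * (d.choose i : ℂ)) * X ^ i by simp; ring, coeff_C_mul_X_pow]
  rw [Finset.sum_congr rfl fun i _ => this i, Finset.sum_ite_eq]
  split_ifs with h
  · rfl
  · rw [Nat.choose_eq_zero_of_lt (by simpa using h)]; simp

lemma choose_succ_mul (d j : ℕ) (hj : j ≤ d) :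
    ((j : ℂ) + 1) * (d.choose (j + 1) : ℂ) = ((d : ℂ) - j) * d.choose j := by
  have := Nat.choose_succ_right_eq d j
  have h : ((d.choose (j + 1) * (j + 1) : ℕ) : ℂ) = ((d.choose j * (d - j) : ℕ) : ℂ) := by rw [this]
  push_cast [hj] at h
  linear_combination h

/-- The last factor shows that coefficient j + 1 vanishes, for j ≤ d, only if 9(j + 1) = d + 1. -/
lemma succ_mul_coeff_one_sub_pow_mul {d j : ℕ} (hj : j ≤ d) :
    ((j : ℂ) + 1) * ((1 - X : ℂ[X]) ^ d * (1 + 8 * X)).coeff (j + 1) =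
      (-1) ^ j * (d.choose j * (9 * (j + 1) - (d + 1))) := by
  have hexp : (1 - X : ℂ[X]) ^ d * (1 + 8 * X) = (1 - X) ^ d + C 8 * ((1 - X) ^ d * X) := by
    simp only [C_ofNat]; ring
  rw [hexp, coeff_add, coeff_C_mul, coeff_mul_X, coeff_one_sub_pow, coeff_one_sub_pow, pow_succ]
  linear_combination -(-1) ^ j * choose_succ_mul d j hj

lemma coeff_one_sub_pow_mul_ne_zero {d j : ℕ} (hj : j ≤ d + 1) (h9 : 9 * j ≠ d + 1) :
    ((1 - X : ℂ[X]) ^ d * (1 + 8 * X)).coeff j ≠ 0 := by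
  cases j with
  | zero => simp [mul_coeff_zero, coeff_one_sub_pow]
  | succ j =>
    intro h
    have h1 := succ_mul_coeff_one_sub_pow_mul (d := d) (j := j) (by omega)
    have h2 : (d.choose j : ℂ) ≠ 0 := by
      exact_mod_cast (Nat.choose_pos (show j ≤ d by omega)).ne'
    have h3 : (-1 : ℂ) ^ j ≠ 0 := pow_ne_zero _ (by norm_num)
    rw [h, mul_zero] at h1
    have h5 := (mul_eq_zero.1 ((mul_eq_zero.1 h1.symm).resolve_left h3)).resolve_left h2
    refine h9 ?_
    have : ((9 * (j + 1) : ℕ) : ℂ) = ((d + 1 : ℕ) : ℂ) := by push_cast; linear_combination h5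
    exact_mod_cast this

lemma coeff_one_sub_pow_mul_eq_zero {d j : ℕ} (h9 : 9 * j = d + 1) :
    ((1 - X : ℂ[X]) ^ d * (1 + 8 * X)).coeff j = 0 := by
  obtain ⟨j, rfl⟩ := Nat.exists_eq_succ_of_ne_zero (show j ≠ 0 by omega)
  have h1 := succ_mul_coeff_one_sub_pow_mul (d := d) (j := j) (by omega)
  have h2 : (9 * (j + 1) - (d + 1) : ℂ) = 0 := by
    rw [sub_eq_zero]
    exact_mod_cast h9
  rw [h2, mul_zero, mul_zero] at h1
  exact (mul_eq_zero.1 h1).resolve_left (Nat.cast_add_one_ne_zero j)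

/-- The quadratic in `hd` is (i + 1)(i + 2) times the coefficient of index i + 2, divided by ± the
binomial coefficient of d over i. -/
lemma coeff_one_sub_pow_mul_ne_zero' {d j : ℕ} (hj : j ≤ d + 2)
    (hd : ∀ i : ℕ, i ≤ d → ((d : ℤ) - i) * (d - i - 1) + 20 * (i + 2) * (d - i) -
      8 * (i + 1) * (i + 2) ≠ 0) :
    ((1 - X : ℂ[X]) ^ d * (1 - 20 * X - 8 * X ^ 2)).coeff j ≠ 0 := by
  have hexp : (1 - X : ℂ[X]) ^ d * (1 - 20 * X - 8 * X ^ 2) =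
      (1 - X) ^ d - C 20 * ((1 - X) ^ d * X) - C 8 * ((1 - X) ^ d * X * X) := by
    simp only [C_ofNat]; ring
  rw [hexp]
  match j with
  | 0 => simp [coeff_one_sub_pow]
  | 1 =>
    have e1 : ((1 - X : ℂ[X]) ^ d * X).coeff 1 = ((1 - X : ℂ[X]) ^ d).coeff 0 := coeff_mul_X _ 0
    have e2 : ((1 - X : ℂ[X]) ^ d * X * X).coeff 1 = 0 := by
      rw [coeff_mul_X _ 0, coeff_mul_X_zero]
    rw [coeff_sub, coeff_sub, coeff_C_mul, coeff_C_mul, e1, e2, coeff_one_sub_pow,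
      coeff_one_sub_pow, ← neg_ne_zero, Nat.choose_one_right, Nat.choose_zero_right]
    have : ((d + 20 : ℕ) : ℂ) ≠ 0 := Nat.cast_ne_zero.2 (by omega)
    push_cast at this ⊢
    intro h
    exact this (by linear_combination h)
  | j + 2 =>
    rw [coeff_sub, coeff_sub, coeff_C_mul, coeff_C_mul, coeff_mul_X, coeff_mul_X, coeff_mul_X,
      coeff_one_sub_pow, coeff_one_sub_pow, coeff_one_sub_pow]
    intro h
    have hjd : j ≤ d := by omega
    have h1 := choose_succ_mul d j hjd
    have h1' : ((j : ℂ) + 2) * (d.choose (j + 1 + 1) : ℂ) =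
        ((d : ℂ) - j - 1) * d.choose (j + 1) := by
      by_cases hj1 : j + 1 ≤ d
      · have := choose_succ_mul d (j + 1) hj1
        push_cast at this
        linear_combination this
      · rw [Nat.choose_eq_zero_of_lt (show d < j + 1 by omega),
          Nat.choose_eq_zero_of_lt (show d < j + 1 + 1 by omega)]
        simp
    have h2 : (d.choose j : ℂ) ≠ 0 := by
      exact_mod_cast (Nat.choose_pos hjd).ne'
    have h3 : (-1 : ℂ) ^ j ≠ 0 := pow_ne_zero _ (by norm_num)
    have h4 : (-1 : ℂ) ^ j * ((d.choose j : ℂ) * (((d : ℂ) - j) * (d - j - 1) +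
        20 * (j + 2) * (d - j) - 8 * (j + 1) * (j + 2))) = 0 := by
      rw [pow_succ, pow_succ] at h
      linear_combination (j + 1 : ℂ) * (j + 2) * h - (-1) ^ j * (j + 1) * h1' -
        (-1) ^ j * ((d : ℂ) - j - 1 + 20 * (j + 2)) * h1
    have h5 := (mul_eq_zero.1 ((mul_eq_zero.1 h4).resolve_left h3)).resolve_left h2
    exact hd j hjd (by exact_mod_cast h5)

/-- At the degrees `6 - 2r`, `8 - 2r`, `9 - 2r` the sums over all `D_w` are, up to one common
factor, the coefficients of an explicit polynomial. -/
theorem IsExtremalTypeIII.exists_diffSum_eq (hC : IsExtremalTypeIII C) (hn : n = 12 * m + 4 * r)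
    (hr : r ≤ 2) {l : List (Fin n × Fin n)} (hl : (points l).Nodup) (hne : l ≠ [])
    (hlD : l.length ≤ 3 * m + 3) {q : ℂ[X]}
    (h : l.length + 2 * r = 6 ∧ q = 1 ∨ l.length + 2 * r = 8 ∧ q = 1 + 8 * X ∨
      l.length + 2 * r = 9 ∧ q = 1 - 20 * X - 8 * X ^ 2) :
    ∃ c : ℂ, ∀ j, (diffSum l (supportDesign C (3 * m + 3 + 3 * j)) : ℂ) =
      c * ((1 - X) ^ (3 * m + 3 - l.length) * q).coeff j := by
  rcases hC.diffEnumerator_eq hn hr hl hne hlD with h0 | ⟨Q, κ, hQ, hdeg, hinv⟩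
  · refine ⟨0, fun j => ?_⟩
    rw [diffSum_eq_zero_of_diffEnumerator hl h0]
    simp
  · suffices ∃ c, Q = Polynomial.C c * q by
      obtain ⟨c, rfl⟩ := this
      refine ⟨c, fun j => ?_⟩
      rw [hQ j, mul_left_comm, coeff_C_mul]
    rcases h with ⟨h, rfl⟩ | ⟨h, rfl⟩ | ⟨h, rfl⟩
    · simpa using eq_C_of_invariant_zero (Q := Q) (by omega)
    · rw [show 2 * l.length + 4 * r - 12 = 4 by omega] at hinv
      exact eq_of_invariant_four (by omega) hinv
    · rw [show 2 * l.length + 4 * r - 12 = 6 by omega] at hinv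
      exact eq_of_invariant_six (by omega) hinv

/-- Either all sums of degree `t + 1` vanish, or `δ = s = t`, provided that the polynomial
belonging to the degree `t + 1` has no vanishing coefficient. -/
theorem IsExtremalTypeIII.vanish_or_eq (hC : IsExtremalTypeIII C) (hn : n = 12 * m + 4 * r)
    (hr : r ≤ 2) {t : ℕ} (htD : t + 1 ≤ 3 * m + 3) (htn : 3 * m + 3 + (t + 1) ≤ n)
    (hvan : DiffSumsVanish C t) {q : ℂ[X]}
    (h : t + 1 + 2 * r = 6 ∧ q = 1 ∨ t + 1 + 2 * r = 8 ∧ q = 1 + 8 * X ∨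
      t + 1 + 2 * r = 9 ∧ q = 1 - 20 * X - 8 * X ^ 2)
    (hq : ∀ j, 3 * m + 3 + 3 * j + (t + 1) ≤ n →
      ((1 - X) ^ (3 * m + 3 - (t + 1)) * q).coeff j ≠ 0) :
    DiffSumsVanish C (t + 1) ∨ delta C = t ∧ s C = t := by
  refine or_iff_not_imp_right.2 fun hδ => hvan.succ fun l hl hlen => ?_
  have hne : l ≠ [] := by rintro rfl; simp at hlen
  obtain ⟨c, hc⟩ := hC.exists_diffSum_eq hn hr hl hne (by omega) (q := q) (by rwa [hlen])
  rw [hlen] at hc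
  refine hC.diffSum_eq_zero_of_forall (m := m) (by omega) hne fun j => ?_
  by_cases h0 : c = 0
  · have := hc j
    rw [h0, zero_mul] at this
    exact_mod_cast this
  · refine (hδ (hC.delta_eq_and_s_eq (by omega) htD htn hvan hl hlen fun j hj h0' => ?_)).elim
    have := hc j
    rw [h0', Int.cast_zero] at this
    exact mul_ne_zero h0 (hq j hj) this.symm

end Extremal

end TernaryCode

/-! ### Gleason's theorem for the weight enumerator. -/

namespace TernaryCode

section Gleason

open Polynomial

lemma MacWilliamsInvariant.sub {N : ℕ} {κ : ℂ} {P Q : ℂ[X]} (hP : MacWilliamsInvariant N κ P)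
    (hQ : MacWilliamsInvariant N κ Q) : MacWilliamsInvariant N κ (P - Q) := by
  intro y hy
  rw [eval_sub, eval_sub, mul_sub, mul_sub, hP y hy, hQ y hy]

lemma invariant_C_mul_pow (M : ℕ) (a : ℂ) :
    MacWilliamsInvariant (4 * M) (9 ^ M) (expand ℂ 3 (C a * (1 + 8 * X) ^ M)) := by
  intro y hy
  simp only [expand_eval, eval_mul, eval_C, eval_pow, eval_add, eval_one, eval_ofNat, eval_X,
    pow_mul]
  have h : (1 + 2 * y) ^ 4 * (1 + 8 * ((1 - y) / (1 + 2 * y)) ^ 3) = 9 * (1 + 8 * y ^ 3) := by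
    have hu : (1 + 2 * y) * ((1 - y) / (1 + 2 * y)) = 1 - y := mul_div_cancel₀ _ hy
    generalize (1 - y) / (1 + 2 * y) = u at hu
    calc (1 + 2 * y) ^ 4 * (1 + 8 * u ^ 3) =
        (1 + 2 * y) * ((1 + 2 * y) ^ 3 + 8 * ((1 + 2 * y) * u) ^ 3) := by ring
      _ = 9 * (1 + 8 * y ^ 3) := by rw [hu]; ring
  rw [mul_left_comm, ← mul_pow, h, mul_pow]
  ring

/-- Gleason's theorem: invariants are polynomials in `x (x³ + 8 y³)` and `(y (x³ - y³))³`. -/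
theorem exists_eq_sum_of_invariant {r : ℕ} (hr : r ≤ 2) (m : ℕ) : ∀ {R : ℂ[X]},
    3 * R.natDegree ≤ 4 * (3 * m + r) →
    MacWilliamsInvariant (4 * (3 * m + r)) (9 ^ (3 * m + r)) (expand ℂ 3 R) →
    ∃ a : ℕ → ℂ, R = ∑ i ∈ Finset.range (m + 1),
      C (a i) * ((1 + 8 * X) ^ (3 * (m - i) + r) * (X * (1 - X) ^ 3) ^ i) := by
  have h18 : (1 + 8 * X : ℂ[X]).natDegree ≤ 1 := by
    rw [show (1 + 8 * X : ℂ[X]) = C 8 * X + C 1 by simp [C_ofNat]; ring]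
    exact natDegree_linear_le
  have step : ∀ (M : ℕ) (R : ℂ[X]), 3 * R.natDegree ≤ 4 * M →
      MacWilliamsInvariant (4 * M) (9 ^ M) (expand ℂ 3 R) →
      R - C (R.coeff 0) * (1 + 8 * X) ^ M = 0 ∨ ∃ Q : ℂ[X],
        R - C (R.coeff 0) * (1 + 8 * X) ^ M = X * (1 - X) ^ 3 * Q ∧
        12 + 3 * Q.natDegree ≤ 4 * M ∧
        MacWilliamsInvariant (4 * M - 12) (9 ^ M / 9 ^ 3) (expand ℂ 3 Q) := by
    intro M R hdeg hinv
    refine or_iff_not_imp_left.2 fun h0 => ?_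
    set S := R - C (R.coeff 0) * (1 + 8 * X) ^ M with hS
    have hSdeg : 3 * S.natDegree ≤ 4 * M := by
      have h1 : (C (R.coeff 0) * (1 + 8 * X) ^ M : ℂ[X]).natDegree ≤ M :=
        (natDegree_C_mul_le _ _).trans ((natDegree_pow_le).trans (by nlinarith))
      have h2 := natDegree_sub_le R (C (R.coeff 0) * (1 + 8 * X) ^ M)
      rw [← hS] at h2
      omega
    -- Without its constant term the invariant starts at Y³ at the earliest, so the structure
    -- theorem with d = 3 splits off (Y (1 - Y³))³ = z (1 - z)³ and lowers the degree by 12.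
    obtain ⟨Q, hQ, hQdeg, hQinv⟩ := exists_eq_pow_mul_expand (P := expand ℂ 3 S) (N := 4 * M)
      (d := 3) (pow_ne_zero M (by norm_num : (9 : ℂ) ≠ 0)) (by rw [natDegree_expand]; omega)
      (by rw [hS, map_sub]; exact hinv.sub (invariant_C_mul_pow M _))
      (by
        intro i hi
        rw [coeff_expand (by norm_num)] at hi
        split_ifs at hi with h3
        · obtain ⟨k, rfl⟩ := h3
          rw [Nat.mul_div_cancel_left _ (by norm_num)] at hi
          rcases Nat.eq_zero_or_pos k with rfl | hk
          · exfalso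
            apply hi
            rw [hS, coeff_sub, coeff_C_mul, coeff_zero_eq_eval_zero ((1 + 8 * X : ℂ[X]) ^ M)]
            simp
          · exact ⟨by omega, k - 1, by omega⟩
        · exact (hi rfl).elim)
      (by rwa [ne_eq, expand_eq_zero (by norm_num)])
    refine ⟨Q, ?_, by omega, hQinv⟩
    refine expand_injective (R := ℂ) (n := 3) (by norm_num) ?_
    rw [hQ, mul_assoc X, map_mul _ X, expand_X]
  induction m with
  | zero =>
    intro R hdeg hinv
    rw [mul_zero, zero_add] at hdeg hinv
    refine ⟨fun _ => R.coeff 0, ?_⟩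
    rcases step r R hdeg hinv with h | ⟨Q, _, hQ, _⟩
    · simpa using sub_eq_zero.1 h
    · omega
  | succ m ih =>
    intro R hdeg hinv
    obtain ⟨Q, hRQ, hQdeg, hQinv⟩ : ∃ Q : ℂ[X],
        R - C (R.coeff 0) * (1 + 8 * X) ^ (3 * (m + 1) + r) = X * (1 - X) ^ 3 * Q ∧
        3 * Q.natDegree ≤ 4 * (3 * m + r) ∧
        MacWilliamsInvariant (4 * (3 * m + r)) (9 ^ (3 * m + r)) (expand ℂ 3 Q) := by
      rcases step _ R hdeg hinv with h | ⟨Q, h1, h2, h3⟩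
      · refine ⟨0, by rw [h, mul_zero], by simp, fun y _ => by simp⟩
      · refine ⟨Q, h1, by omega, ?_⟩
        have h9 : (9 : ℂ) ^ (3 * (m + 1) + r) / 9 ^ 3 = 9 ^ (3 * m + r) := by
          rw [div_eq_iff (by norm_num), ← pow_add]
          congr 1
          ring
        rwa [h9, show 4 * (3 * (m + 1) + r) - 12 = 4 * (3 * m + r) by omega] at h3
    obtain ⟨a, ha⟩ := ih hQdeg hQinv
    generalize R.coeff 0 = c at hRQ
    refine ⟨fun i => Nat.casesOn i c a, ?_⟩
    rw [Finset.sum_range_succ', eq_add_of_sub_eq hRQ]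
    congr 1
    · rw [ha, Finset.mul_sum]
      refine Finset.sum_congr rfl fun i hi => ?_
      rw [Nat.add_sub_add_right, pow_succ _ i]
      ring
    · simp

variable {n m r : ℕ} {C : LinearCode n}

/-- Invariance at y = 0 and y = 1 gives |C|² = 3 ^ n. -/
lemma card_codewords_eq (hC : C = dual C) {M : ℕ} (hn : n = 4 * M) :
    ((codewords C).card : ℂ) = 9 ^ M := by
  have hinv := diffEnumerator_invariant hC (l := []) (by simp)
  have e0 := hinv 0 (by norm_num)
  have e1 := hinv 1 (by norm_num)
  simp only [List.length_nil, mul_zero, Nat.sub_zero, pow_zero, div_one] at e0 e1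
  norm_num at e0 e1
  have h1 : (diffEnumerator C []).eval 1 = (codewords C).card := by
    simp [diffEnumerator, eval_finsetSum]
  have h0 : (diffEnumerator C []).eval 0 = 1 := by
    rw [h1] at e0
    exact mul_left_cancel₀ card_codewords_ne_zero (by rw [← e0, mul_one])
  rw [h1, h0, congrArg (HPow.hPow (3 : ℂ)) hn] at e1
  have h2 : (((codewords C).card : ℕ) : ℂ) ^ 2 = ((9 ^ M : ℕ) : ℂ) ^ 2 := by
    rw [pow_two, ← e1]
    push_cast
    rw [← pow_mul, mul_one, show (9 : ℂ) = 3 ^ 2 by norm_num, ← pow_mul]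
    congr 1
    ring
  have h3 : (codewords C).card ^ 2 = (9 ^ M) ^ 2 := by exact_mod_cast h2
  have := Nat.pow_left_injective (n := 2) (by norm_num) h3
  rw [this]
  push_cast
  rfl

/-- The weight enumerator of a Type III code, in the variable `z = Y³`. -/
theorem IsTypeIII.exists_weightEnumerator (hC : IsTypeIII C) (hn : n = 12 * m + 4 * r)
    (hr : r ≤ 2) : ∃ a : ℕ → ℂ, ∀ j, ((supportDesign C (3 * j)).card : ℂ) =
      (∑ i ∈ Finset.range (m + 1),
        Polynomial.C (a i) * ((1 + 8 * X) ^ (3 * (m - i) + r) * (X * (1 - X) ^ 3) ^ i)).coeff j := by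
  have hcoeff := diffEnumerator_coeff C (l := []) (by simp)
  obtain ⟨R, hR⟩ := eq_X_pow_mul_expand (P := diffEnumerator C []) (d := 0) (by
    intro i hi
    rw [hcoeff, card_supportDesign] at hi
    have hi' : supportDesign C i ≠ 0 := by
      rintro h0
      simp [h0] at hi
    obtain ⟨x, hx, rfl⟩ := supportDesign_ne_zero.1 hi'
    exact ⟨Nat.zero_le _, by simpa using hC.2 x hx⟩)
  rw [pow_zero, one_mul] at hR
  have hinv := diffEnumerator_invariant hC.1 (l := []) (by simp)
  have hdeg := diffEnumerator_natDegree_le (C := C) (l := []) (by simp)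
  rw [card_codewords_eq hC.1 (M := 3 * m + r) (by omega), hR] at hinv
  rw [hR, natDegree_expand] at hdeg
  simp only [List.length_nil, mul_zero, Nat.sub_zero, pow_zero, div_one] at hinv hdeg
  rw [show n = 4 * (3 * m + r) by omega] at hinv
  obtain ⟨a, ha⟩ := exists_eq_sum_of_invariant hr m (by omega) hinv
  refine ⟨a, fun j => ?_⟩
  rw [← ha]
  have h := hcoeff (3 * j)
  rw [hR, mul_comm 3 j, coeff_expand_mul (by norm_num), card_supportDesign] at h
  rw [mul_comm 3 j, h]
  simp

end Gleason

end TernaryCode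

/-! ### Lagrange inversion for the first two nontrivial coefficients. -/

namespace TernaryCode

section Lagrange

open PowerSeries

/-- `∑ zⁱ = (1 - z)⁻¹`. -/
noncomputable abbrev geom : ℂ⟦X⟧ := PowerSeries.mk 1

lemma geom_mul : geom * (1 - X) = 1 := PowerSeries.mk_one_mul_one_sub_eq_one ℂ

lemma derivative_geom : d⁄dX ℂ geom = geom ^ 2 := by
  have h := congrArg (d⁄dX ℂ) geom_mul
  simp only [Derivation.leibniz, map_sub, Derivation.map_one_eq_zero, derivative_X, smul_eq_mul,
    zero_sub] at h
  linear_combination geom * h - d⁄dX ℂ geom * geom_mul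

lemma coeff_X_mul_derivative (f : ℂ⟦X⟧) (s : ℕ) : coeff s (X * d⁄dX ℂ f) = s * coeff s f := by
  cases s with
  | zero => simp
  | succ s =>
    rw [coeff_succ_X_mul, coeff_derivative]
    push_cast
    ring

lemma derivative_one_add : d⁄dX ℂ (1 + 8 * X : ℂ⟦X⟧) = 8 := by
  have : (8 : ℂ⟦X⟧) = C 8 := (map_ofNat C 8).symm
  rw [this, map_add, Derivation.map_one_eq_zero, Derivation.leibniz, derivative_X, derivative_C]
  simp

lemma derivative_one_sub : d⁄dX ℂ (1 - X : ℂ⟦X⟧) = -1 := by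
  rw [map_sub, Derivation.map_one_eq_zero, derivative_X, zero_sub]

/-- Put φ = z (1 - z)³ / (1 + 8z)³, so that φ' / φ = (1 - 20z - 8z²) / (z (1 - z)(1 + 8z)). The
coefficient is the residue of φ ^ (-(s + 2)) dφ, which is exact; G is z ^ (s + 1) φ ^ (-(s + 1)). -/
lemma coeff_residue (s : ℕ) :
    coeff (s + 1) ((1 + 8 * X) ^ (3 * s + 2) * (1 - 20 * X - 8 * X ^ 2) *
      geom ^ (3 * s + 4) : ℂ⟦X⟧) = 0 := by
  set G : ℂ⟦X⟧ := (1 + 8 * X) ^ (3 * s + 3) * geom ^ (3 * s + 3) with hG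
  have hd : X * d⁄dX ℂ G - ((s + 1 : ℕ) : ℂ⟦X⟧) * G =
      -((s + 1 : ℕ) : ℂ⟦X⟧) * ((1 + 8 * X) ^ (3 * s + 2) * (1 - 20 * X - 8 * X ^ 2) *
        geom ^ (3 * s + 4)) := by
    rw [hG, Derivation.leibniz, Derivation.leibniz_pow, Derivation.leibniz_pow, derivative_geom,
      derivative_one_add]
    simp only [smul_eq_mul, nsmul_eq_mul, show 3 * s + 3 - 1 = 3 * s + 2 by omega]
    push_cast
    linear_combination (-((s : ℂ⟦X⟧) + 1) * (1 + 8 * X) ^ (3 * s + 2) * geom ^ (3 * s + 3) *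
      (24 * X - (1 + 8 * X))) * geom_mul
  have h := congrArg (coeff (s + 1)) hd
  rw [map_sub, coeff_X_mul_derivative, show ((s + 1 : ℕ) : ℂ⟦X⟧) = C ((s + 1 : ℕ) : ℂ) by simp,
    coeff_C_mul, sub_self, ← map_neg, coeff_C_mul] at h
  refine (mul_eq_zero.1 h.symm).resolve_left ?_
  exact neg_ne_zero.2 (Nat.cast_ne_zero.2 s.succ_ne_zero)

/-- The linear form of Lagrange inversion vanishes on each generator. -/
lemma coeff_lagrange_generator {m i r q : ℕ} (hi : i ≤ m) (hrq : r + q = 2) (e : ℕ) :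
    coeff (m + e) ((1 + 8 * X) ^ (q + 3 * e) * geom ^ (3 * (m + 1 + e)) *
      ((1 + 8 * X) * d⁄dX ℂ ((1 + 8 * X) ^ (3 * (m - i) + r) * (X * (1 - X) ^ 3) ^ i) -
        8 * ((3 * m + r : ℕ) : ℂ⟦X⟧) * ((1 + 8 * X) ^ (3 * (m - i) + r) * (X * (1 - X) ^ 3) ^ i)) :
          ℂ⟦X⟧) = 0 := by
  obtain ⟨p, rfl⟩ := Nat.exists_eq_add_of_le hi
  rw [Nat.add_sub_cancel_left]
  have hpow : ∀ k : ℕ, (1 + 8 * X : ℂ⟦X⟧) * d⁄dX ℂ ((1 + 8 * X) ^ k) =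
      8 * (k : ℂ⟦X⟧) * (1 + 8 * X) ^ k := by
    intro k
    rw [Derivation.leibniz_pow, derivative_one_add]
    cases k with
    | zero => simp
    | succ k => simp only [smul_eq_mul, nsmul_eq_mul, Nat.add_sub_cancel, pow_succ]; ring
  rcases i with _ | i
  · simp only [pow_zero, mul_one, zero_add, hpow, sub_self, mul_zero, map_zero]
  -- The bracket is (1 + 8z) ^ (3m + r + 1) times the derivative of φ ^ (i + 1). So the coefficient
  -- is i + 1 times the residue of φ ^ (i - (m + 1 + e)) dφ, that is, `coeff_residue` with s = p +
  -- e.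
  · have key : ((1 + 8 * X) ^ (q + 3 * e) * geom ^ (3 * (i + 1 + p + 1 + e)) *
        ((1 + 8 * X) * d⁄dX ℂ ((1 + 8 * X) ^ (3 * p + r) * (X * (1 - X) ^ 3) ^ (i + 1)) -
        8 * ((3 * (i + 1 + p) + r : ℕ) : ℂ⟦X⟧) *
          ((1 + 8 * X) ^ (3 * p + r) * (X * (1 - X) ^ 3) ^ (i + 1))) : ℂ⟦X⟧) =
        C (i + 1 : ℂ) * (X ^ i * ((1 + 8 * X) ^ (3 * (p + e) + 2) * (1 - 20 * X - 8 * X ^ 2) *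
          geom ^ (3 * (p + e) + 4))) := by
      have hΔ : d⁄dX ℂ (X * (1 - X) ^ 3 : ℂ⟦X⟧) = (1 - X) ^ 2 * (1 - 4 * X) := by
        rw [Derivation.leibniz, Derivation.leibniz_pow, derivative_one_sub, derivative_X]
        simp only [smul_eq_mul, nsmul_eq_mul]
        push_cast
        ring
      have hg : geom ^ (3 * (i + 1 + p + 1 + e)) * (1 - X) ^ (3 * i + 2) =
          geom ^ (3 * (p + e) + 4) := by
        rw [show 3 * (i + 1 + p + 1 + e) = 3 * (p + e) + 4 + (3 * i + 2) by ring, pow_add, mul_assoc,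
          ← mul_pow, geom_mul, one_pow, mul_one]
      have hD := hpow (3 * p + r)
      rw [Derivation.leibniz, Derivation.leibniz_pow, hΔ, smul_eq_mul, smul_eq_mul, smul_eq_mul,
        nsmul_eq_mul, show i + 1 - 1 = i by omega,
        show 3 * (p + e) + 2 = (3 * p + r) + (q + 3 * e) by omega]
      simp only [map_add, map_one, map_natCast, mul_pow (X : ℂ⟦X⟧) ((1 - X) ^ 3),
        ← pow_mul]
      push_cast at hD ⊢
      linear_combination ((1 + 8 * X) ^ (q + 3 * e) * geom ^ (3 * (i + 1 + p + 1 + e)) *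
          (X ^ (i + 1) * (1 - X) ^ (3 * (i + 1)))) * hD +
        ((i + 1 : ℂ⟦X⟧) * (1 + 8 * X) ^ (q + 3 * e) * (1 + 8 * X) ^ (3 * p + r) *
          (1 - 20 * X - 8 * X ^ 2) * X ^ i) * hg
    rw [key, coeff_C_mul, show i + 1 + p + e = (p + e + 1) + i by ring, coeff_X_pow_mul,
      coeff_residue, mul_zero]

/-- The coefficient of `z ^ k` in `(1 + 8 z) ^ e * (1 - z) ^ (-(s + 1))`. -/
def lagrangeCoeff : ℕ → ℕ → ℕ → ℕ
  | 0, s, k => (s + k).choose s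
  | _ + 1, _, 0 => 1
  | e + 1, s, k + 1 => lagrangeCoeff e s (k + 1) + 8 * lagrangeCoeff e s k

lemma lagrangeCoeff_zero (e s : ℕ) : lagrangeCoeff e s 0 = 1 := by
  cases e <;> simp [lagrangeCoeff]

lemma lagrangeCoeff_one (e s : ℕ) : lagrangeCoeff e s 1 = 8 * e + s + 1 := by
  induction e with
  | zero => simp [lagrangeCoeff]
  | succ e ih => simp only [lagrangeCoeff, ih, lagrangeCoeff_zero]; ring

lemma coeff_eq_lagrangeCoeff (e s k : ℕ) :
    coeff k ((1 + 8 * X) ^ e * geom ^ (s + 1) : ℂ⟦X⟧) = lagrangeCoeff e s k := by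
  induction e generalizing k with
  | zero =>
    rw [pow_zero, one_mul, PowerSeries.mk_one_pow_eq_mk_choose_add, coeff_mk]
    rfl
  | succ e ih =>
    have : ((1 + 8 * X) ^ (e + 1) * geom ^ (s + 1) : ℂ⟦X⟧) =
        (1 + 8 * X) ^ e * geom ^ (s + 1) +
          C 8 * (X * ((1 + 8 * X) ^ e * geom ^ (s + 1))) := by
      rw [show (C 8 : ℂ⟦X⟧) = 8 from map_ofNat C 8]
      ring
    rw [this, map_add, coeff_C_mul, ih]
    cases k with
    | zero => simp [lagrangeCoeff_zero]
    | succ k =>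
      rw [coeff_succ_X_mul, ih]
      simp [lagrangeCoeff]

/-- The relation on the coefficients of a combination of the generators given by Lagrange
inversion. -/
lemma coeff_lagrange {m r q : ℕ} (hrq : r + q = 2) (e : ℕ) (a : ℕ → ℂ) {F : ℂ⟦X⟧}
    (hF : F = ((∑ i ∈ Finset.range (m + 1), Polynomial.C (a i) *
      ((1 + 8 * Polynomial.X) ^ (3 * (m - i) + r) *
        (Polynomial.X * (1 - Polynomial.X) ^ 3) ^ i) : Polynomial ℂ) : ℂ⟦X⟧)) :
    coeff (m + e) ((1 + 8 * X) ^ (q + 3 * e) * geom ^ (3 * (m + 1 + e)) *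
      ((1 + 8 * X) * d⁄dX ℂ F - 8 * ((3 * m + r : ℕ) : ℂ⟦X⟧) * F)) = 0 := by
  have h8 : ((8 : Polynomial ℂ) : ℂ⟦X⟧) = 8 := by
    rw [show (8 : Polynomial ℂ) = Polynomial.C 8 from rfl, Polynomial.coe_C]
    exact map_ofNat C 8
  have hF' : F = ∑ i ∈ Finset.range (m + 1),
      C (a i) * ((1 + 8 * X) ^ (3 * (m - i) + r) * (X * (1 - X) ^ 3) ^ i) := by
    rw [hF, ← Polynomial.coeToPowerSeries.ringHom_apply, map_sum]
    refine Finset.sum_congr rfl fun i _ => ?_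
    simp only [Polynomial.coeToPowerSeries.ringHom_apply, Polynomial.coe_mul, Polynomial.coe_C,
      Polynomial.coe_pow, Polynomial.coe_add, Polynomial.coe_sub, Polynomial.coe_one,
      Polynomial.coe_X, h8]
  clear hF
  subst hF'
  refine Finset.sum_induction _ (fun F : ℂ⟦X⟧ => coeff (m + e) ((1 + 8 * X) ^ (q + 3 * e) *
    geom ^ (3 * (m + 1 + e)) * ((1 + 8 * X) * d⁄dX ℂ F - 8 * ((3 * m + r : ℕ) : ℂ⟦X⟧) * F)) = 0) ?_ ?_ ?_
  · intro F G h1 h2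
    rw [map_add]
    have h3 := congrArg₂ (· + ·) h1 h2
    simp only [add_zero] at h3
    rw [← map_add] at h3
    rw [← h3]
    congr 1
    ring
  · simp
  · intro i hi
    have h := coeff_lagrange_generator (m := m) (Nat.lt_succ_iff.1 (Finset.mem_range.1 hi)) hrq e
    generalize ((1 + 8 * X) ^ (3 * (m - i) + r) * (X * (1 - X) ^ 3) ^ i : ℂ⟦X⟧) = G at h ⊢
    rw [← mul_zero (a i), ← h, ← coeff_C_mul, Derivation.leibniz, derivative_C, smul_zero, add_zero,
      smul_eq_mul]
    congr 1
    ring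

lemma exists_eq_add_X_pow_mul {m : ℕ} {F : ℂ⟦X⟧} (h0 : coeff 0 F = 1)
    (h : ∀ j, 1 ≤ j → j ≤ m → coeff j F = 0) :
    ∃ T, F = 1 + C (coeff (m + 1) F) * X ^ (m + 1) + C (coeff (m + 2) F) * X ^ (m + 2) +
      X ^ (m + 3) * T := by
  have : X ^ (m + 3) ∣ F - (1 + C (coeff (m + 1) F) * X ^ (m + 1) +
      C (coeff (m + 2) F) * X ^ (m + 2)) := by
    rw [X_pow_dvd_iff]
    intro j hj
    rw [map_sub, map_add, map_add, coeff_C_mul, coeff_C_mul, coeff_X_pow, coeff_X_pow, coeff_one]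
    rcases Nat.eq_zero_or_pos j with rfl | hpos
    · simp [h0]
    rcases Nat.lt_or_ge m j with hm | hm
    · obtain rfl | rfl : j = m + 1 ∨ j = m + 2 := by omega
      · simp
      · simp
    · rw [h j hpos hm]
      simp [show j ≠ m + 1 by omega, show j ≠ m + 2 by omega, show j ≠ 0 by omega]
  obtain ⟨T, hT⟩ := this
  exact ⟨T, by rw [← hT]; ring⟩

/-- With e = 0 the linear form sees only the constant term of F and its coefficient at m + 1. -/
theorem first_coeff_eq {m r q : ℕ} (hrq : r + q = 2) (a : ℕ → ℂ) {F : ℂ⟦X⟧}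
    (hF : F = ((∑ i ∈ Finset.range (m + 1), Polynomial.C (a i) *
      ((1 + 8 * Polynomial.X) ^ (3 * (m - i) + r) *
        (Polynomial.X * (1 - Polynomial.X) ^ 3) ^ i) : Polynomial ℂ) : ℂ⟦X⟧))
    (h0 : coeff 0 F = 1) (h : ∀ j, 1 ≤ j → j ≤ m → coeff j F = 0) :
    (m + 1) * coeff (m + 1) F = 8 * (3 * m + r) * lagrangeCoeff q (3 * m + 2) m := by
  have hL := coeff_lagrange hrq 0 a hF
  obtain ⟨T, hT⟩ := exists_eq_add_X_pow_mul h0 h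
  generalize coeff (m + 1) F = A at hT ⊢
  generalize coeff (m + 2) F = B at hT
  have key : ∃ S, (1 + 8 * X) * d⁄dX ℂ F - 8 * ((3 * m + r : ℕ) : ℂ⟦X⟧) * F =
      C (-8 * (3 * m + r) : ℂ) + C ((m + 1) * A) * X ^ m + X ^ (m + 1) * S := by
    refine ⟨8 * ((m : ℂ⟦X⟧) + 1) * C A + (1 + 8 * X) * (((m : ℂ⟦X⟧) + 2) * C B +
      ((m : ℂ⟦X⟧) + 3) * X * T + X ^ 2 * d⁄dX ℂ T) -
      8 * ((3 * m + r : ℕ) : ℂ⟦X⟧) * (C A + C B * X + X ^ 2 * T), ?_⟩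
    rw [hT]
    simp only [map_add, Derivation.map_one_eq_zero, Derivation.leibniz, Derivation.leibniz_pow,
      derivative_C, derivative_X, smul_eq_mul, nsmul_eq_mul, map_mul, map_natCast, map_neg,
      map_one, Nat.add_sub_cancel, show m + 2 - 1 = m + 1 by omega,
      show m + 3 - 1 = m + 2 by omega, show (C 8 : ℂ⟦X⟧) = 8 from map_ofNat C 8,
      show (C 3 : ℂ⟦X⟧) = 3 from map_ofNat C 3]
    push_cast
    ring
  obtain ⟨S, hS⟩ := key
  rw [hS, add_zero, mul_zero, add_zero, add_zero, show 3 * (m + 1) = (3 * m + 2) + 1 by ring,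
    mul_add, mul_add, mul_left_comm _ _ (X ^ m), mul_left_comm _ (X ^ (m + 1)), mul_comm _ (C _),
    map_add, map_add, coeff_C_mul, coeff_C_mul, coeff_eq_lagrangeCoeff,
    coeff_mul_X_pow' _ m m, coeff_X_pow_mul', if_pos le_rfl, if_neg (by omega), Nat.sub_self,
    coeff_eq_lagrangeCoeff, lagrangeCoeff_zero] at hL
  push_cast at hL
  linear_combination hL

/-- With e = 1 the form also reaches the coefficient at m + 2. -/
theorem second_coeff_eq {m r q : ℕ} (hrq : r + q = 2) (a : ℕ → ℂ) {F : ℂ⟦X⟧}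
    (hF : F = ((∑ i ∈ Finset.range (m + 1), Polynomial.C (a i) *
      ((1 + 8 * Polynomial.X) ^ (3 * (m - i) + r) *
        (Polynomial.X * (1 - Polynomial.X) ^ 3) ^ i) : Polynomial ℂ) : ℂ⟦X⟧))
    (h0 : coeff 0 F = 1) (h : ∀ j, 1 ≤ j → j ≤ m → coeff j F = 0) :
    (m + 2) * coeff (m + 2) F + (m + 2) * (3 * m + 11 + 8 * q) * coeff (m + 1) F =
      8 * (3 * m + r) * lagrangeCoeff (q + 3) (3 * m + 5) (m + 1) := by
  have hL := coeff_lagrange hrq 1 a hF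
  obtain ⟨T, hT⟩ := exists_eq_add_X_pow_mul h0 h
  generalize coeff (m + 1) F = A at hT ⊢
  generalize coeff (m + 2) F = B at hT ⊢
  have key : ∃ S, (1 + 8 * X) * d⁄dX ℂ F - 8 * ((3 * m + r : ℕ) : ℂ⟦X⟧) * F =
      C (-8 * (3 * m + r) : ℂ) + C ((m + 1) * A) * X ^ m +
        C (8 * (m + 1) * A + (m + 2) * B - 8 * (3 * m + r) * A) * X ^ (m + 1) +
          X ^ (m + 2) * S := by
    refine ⟨8 * ((m : ℂ⟦X⟧) + 2) * C B + (1 + 8 * X) * (((m : ℂ⟦X⟧) + 3) * T + X * d⁄dX ℂ T) -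
      8 * ((3 * m + r : ℕ) : ℂ⟦X⟧) * (C B + X * T), ?_⟩
    rw [hT]
    simp only [map_add, map_sub, Derivation.map_one_eq_zero, Derivation.leibniz,
      Derivation.leibniz_pow, derivative_C, derivative_X, smul_eq_mul, nsmul_eq_mul, map_mul,
      map_natCast, map_neg, map_one, Nat.add_sub_cancel, show m + 2 - 1 = m + 1 by omega,
      show m + 3 - 1 = m + 2 by omega, show (C 8 : ℂ⟦X⟧) = 8 from map_ofNat C 8,
      show (C 3 : ℂ⟦X⟧) = 3 from map_ofNat C 3, show (C 2 : ℂ⟦X⟧) = 2 from map_ofNat C 2]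
    push_cast
    ring
  obtain ⟨S, hS⟩ := key
  rw [hS, mul_one, show 3 * (m + 1 + 1) = (3 * m + 5) + 1 by ring,
    mul_add, mul_add, mul_add, mul_left_comm _ _ (X ^ m), mul_left_comm _ _ (X ^ (m + 1)),
    mul_left_comm _ (X ^ (m + 2)), mul_comm _ (C (-8 * (3 * m + r) : ℂ)),
    map_add, map_add, map_add, coeff_C_mul, coeff_C_mul, coeff_C_mul, coeff_eq_lagrangeCoeff,
    coeff_mul_X_pow' _ m, coeff_mul_X_pow' _ (m + 1), coeff_X_pow_mul', if_pos (by omega),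
    if_pos le_rfl, if_neg (by omega), Nat.sub_self, Nat.add_sub_cancel_left,
    coeff_eq_lagrangeCoeff, coeff_eq_lagrangeCoeff, lagrangeCoeff_zero, lagrangeCoeff_one] at hL
  have hr : (r : ℂ) = 2 - q := by rw [eq_sub_iff_add_eq]; exact_mod_cast hrq
  push_cast at hL
  rw [hr] at hL ⊢
  linear_combination hL

end Lagrange

end TernaryCode

/-! ### Numbers of codewords of the two smallest weights, and the bound on m. -/

namespace TernaryCode

section MinimumWeight

variable {n m r : ℕ} {C : LinearCode n}

lemma card_supportDesign_zero (C : LinearCode n) : (supportDesign C 0).card = 1 := by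
  classical
  rw [supportDesign, Multiset.card_map, Finset.card_val, Finset.card_eq_one]
  refine ⟨0, ?_⟩
  ext x
  simp only [Finset.mem_filter, Finset.mem_univ, true_and, hammingNorm_eq_zero,
    Finset.mem_singleton]
  exact ⟨fun h => h.2, by rintro rfl; exact ⟨C.zero_mem, rfl⟩⟩

lemma IsExtremalTypeIII.card_supportDesign_eq_zero (hC : IsExtremalTypeIII C) (hn : n / 12 = m)
    {j : ℕ} (h1 : 1 ≤ j) (hj : j ≤ m) : (supportDesign C (3 * j)).card = 0 := by
  by_contra h0
  obtain ⟨i, hi⟩ := hC.exists_of_ne_zero hn (w := 3 * j) (by omega)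
    (by rintro h; simp [h] at h0)
  omega

theorem IsExtremalTypeIII.card_min (hC : IsExtremalTypeIII C) (hn : n = 12 * m + 4 * r)
    (hr : r ≤ 2) : (m + 1) * (supportDesign C (3 * m + 3)).card =
      8 * (3 * m + r) * lagrangeCoeff (2 - r) (3 * m + 2) m := by
  obtain ⟨a, ha⟩ := hC.1.exists_weightEnumerator hn hr
  have h := first_coeff_eq (m := m) (r := r) (q := 2 - r) (by omega) a rfl
    (by rw [Polynomial.coeff_coe, ← ha, mul_zero, card_supportDesign_zero, Nat.cast_one])
    (fun j h1 hj => by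
      rw [Polynomial.coeff_coe, ← ha, hC.card_supportDesign_eq_zero (by omega) h1 hj,
        Nat.cast_zero])
  rw [Polynomial.coeff_coe, ← ha, show 3 * (m + 1) = 3 * m + 3 by ring] at h
  exact_mod_cast h

theorem IsExtremalTypeIII.card_second (hC : IsExtremalTypeIII C) (hn : n = 12 * m + 4 * r)
    (hr : r ≤ 2) : (m + 2) * (supportDesign C (3 * (m + 2))).card +
      (m + 2) * (3 * m + 11 + 8 * (2 - r)) * (supportDesign C (3 * m + 3)).card =
      8 * (3 * m + r) * lagrangeCoeff (2 - r + 3) (3 * m + 5) (m + 1) := by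
  obtain ⟨a, ha⟩ := hC.1.exists_weightEnumerator hn hr
  have h := second_coeff_eq (m := m) (r := r) (q := 2 - r) (by omega) a rfl
    (by rw [Polynomial.coeff_coe, ← ha, mul_zero, card_supportDesign_zero, Nat.cast_one])
    (fun j h1 hj => by
      rw [Polynomial.coeff_coe, ← ha, hC.card_supportDesign_eq_zero (by omega) h1 hj,
        Nat.cast_zero])
  rw [Polynomial.coeff_coe, Polynomial.coeff_coe, ← ha, ← ha,
    show 3 * (m + 1) = 3 * m + 3 by ring] at h
  exact_mod_cast h

/-- This says that the number of codewords of weight 3m + 6 is not negative, after elimination of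
the minimum weight count. -/
theorem IsExtremalTypeIII.lagrangeCoeff_le (hC : IsExtremalTypeIII C) (hn : n = 12 * m + 4 * r)
    (hr : r ≤ 2) : (m + 2) * (3 * m + 11 + 8 * (2 - r)) * lagrangeCoeff (2 - r) (3 * m + 2) m ≤
      (m + 1) * lagrangeCoeff (2 - r + 3) (3 * m + 5) (m + 1) := by
  have hpos : 0 < 8 * (3 * m + r) := by
    have : n ≠ 0 := by
      rintro rfl
      obtain ⟨x, -, hx, -⟩ := hC.2.1
      exact hx (Subsingleton.elim _ _)
    omega
  refine Nat.le_of_mul_le_mul_left ?_ hpos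
  have h1 := hC.card_min hn hr
  have h2 := hC.card_second hn hr
  generalize (supportDesign C (3 * (m + 2))).card = B at h2
  generalize (supportDesign C (3 * m + 3)).card = A at h1 h2
  calc 8 * (3 * m + r) * ((m + 2) * (3 * m + 11 + 8 * (2 - r)) *
        lagrangeCoeff (2 - r) (3 * m + 2) m) =
        (m + 1) * ((m + 2) * (3 * m + 11 + 8 * (2 - r)) * A) := by
        rw [mul_left_comm, ← h1]; ring
    _ ≤ (m + 1) * ((m + 2) * B + (m + 2) * (3 * m + 11 + 8 * (2 - r)) * A) :=
        Nat.mul_le_mul_left _ (Nat.le_add_left _ _)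
    _ = _ := by rw [h2]; ring

/-- The binomial coefficients in the formulas for the first two coefficients, as multiples of a
common unit. -/
lemma exists_binomial_unit {m : ℕ} (hm : 4 ≤ m) : ∃ u : ℚ, 0 < u ∧
    ((4 * m + 2).choose (3 * m + 2) : ℚ) =
      (3 * m + 3) * (3 * m + 4) * (3 * m + 5) * (4 * m + 1) * (4 * m + 2) * (m + 1) * u ∧
    ((4 * m + 1).choose (3 * m + 2) : ℚ) =
      (3 * m + 3) * (3 * m + 4) * (3 * m + 5) * m * (4 * m + 1) * (m + 1) * u ∧
    ((4 * m).choose (3 * m + 2) : ℚ) =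
      (3 * m + 3) * (3 * m + 4) * (3 * m + 5) * m * (m - 1) * (m + 1) * u ∧
    ((4 * m + 6).choose (3 * m + 5) : ℚ) =
      (4 * m + 1) * (4 * m + 2) * (4 * m + 3) * (4 * m + 4) * (4 * m + 5) * (4 * m + 6) * u ∧
    ((4 * m + 5).choose (3 * m + 5) : ℚ) =
      (4 * m + 1) * (4 * m + 2) * (4 * m + 3) * (4 * m + 4) * (4 * m + 5) * (m + 1) * u ∧
    ((4 * m + 4).choose (3 * m + 5) : ℚ) =
      (4 * m + 1) * (4 * m + 2) * (4 * m + 3) * (4 * m + 4) * m * (m + 1) * u ∧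
    ((4 * m + 3).choose (3 * m + 5) : ℚ) =
      (4 * m + 1) * (4 * m + 2) * (4 * m + 3) * (m - 1) * m * (m + 1) * u ∧
    ((4 * m + 2).choose (3 * m + 5) : ℚ) =
      (4 * m + 1) * (4 * m + 2) * (m - 2) * (m - 1) * m * (m + 1) * u ∧
    ((4 * m + 1).choose (3 * m + 5) : ℚ) =
      (4 * m + 1) * (m - 3) * (m - 2) * (m - 1) * m * (m + 1) * u := by
  have hm' : (4 : ℚ) ≤ m := by exact_mod_cast hm
  have right : ∀ N k d : ℕ, N = k + d →
      (N.choose (k + 1) : ℚ) * (k + 1) = N.choose k * d := by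
    rintro N k d rfl
    have := Nat.choose_succ_right_eq (k + d) k
    rw [Nat.add_sub_cancel_left] at this
    exact_mod_cast this
  have up : ∀ N k d : ℕ, N + 1 = k + d →
      ((N + 1).choose k : ℚ) * d = N.choose k * (N + 1) := by
    intro N k d h
    have := Nat.choose_mul_succ_eq N k
    rw [h, Nat.add_sub_cancel_left, ← h] at this
    exact_mod_cast this.symm
  have k1 := right (4 * m + 2) (3 * m + 2) m (by ring)
  have k2 := right (4 * m + 2) (3 * m + 3) (m - 1) (by omega)
  have k3 := right (4 * m + 2) (3 * m + 4) (m - 2) (by omega)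
  have u6 := up (4 * m + 5) (3 * m + 5) (m + 1) (by ring)
  have u5 := up (4 * m + 4) (3 * m + 5) m (by ring)
  have u4 := up (4 * m + 3) (3 * m + 5) (m - 1) (by omega)
  have u3 := up (4 * m + 2) (3 * m + 5) (m - 2) (by omega)
  have u2 := up (4 * m + 1) (3 * m + 5) (m - 3) (by omega)
  have v2 := up (4 * m + 1) (3 * m + 2) m (by ring)
  have v1 := up (4 * m) (3 * m + 2) (m - 1) (by omega)
  push_cast [show 1 ≤ m by omega, show 2 ≤ m by omega, show 3 ≤ m by omega] at *
  have hy : (0 : ℚ) < (4 * m + 2).choose (3 * m + 2) := by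
    exact_mod_cast Nat.choose_pos (by omega)
  generalize ((4 * m + 2).choose (3 * m + 2) : ℚ) = y at *
  generalize ((4 * m + 1).choose (3 * m + 2) : ℚ) = y' at *
  generalize ((4 * m).choose (3 * m + 2) : ℚ) = y'' at *
  generalize ((4 * m + 2).choose (3 * m + 3) : ℚ) = z1 at *
  generalize ((4 * m + 2).choose (3 * m + 4) : ℚ) = z2 at *
  generalize ((4 * m + 2).choose (3 * m + 5) : ℚ) = c2 at *
  generalize ((4 * m + 1).choose (3 * m + 5) : ℚ) = c1 at *
  generalize ((4 * m + 3).choose (3 * m + 5) : ℚ) = c3 at *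
  generalize ((4 * m + 4).choose (3 * m + 5) : ℚ) = c4 at *
  generalize ((4 * m + 5).choose (3 * m + 5) : ℚ) = c5 at *
  generalize ((4 * m + 6).choose (3 * m + 5) : ℚ) = c6 at *
  generalize (m : ℚ) = x at *
  obtain ⟨u, hu, rfl⟩ : ∃ u : ℚ, 0 < u ∧
      y = (3 * x + 3) * (3 * x + 4) * (3 * x + 5) * (4 * x + 1) * (4 * x + 2) * (x + 1) * u := by
    have hK : 0 < (3 * x + 3) * (3 * x + 4) * (3 * x + 5) * (4 * x + 1) * (4 * x + 2) * (x + 1) := by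
      positivity
    exact ⟨_, div_pos hy hK, (mul_div_cancel₀ _ hK.ne').symm⟩
  have e1 : z1 = (3 * x + 4) * (3 * x + 5) * (4 * x + 1) * (4 * x + 2) * (x + 1) * x * u :=
    mul_right_cancel₀ (show 3 * x + 3 ≠ 0 by positivity) (by linear_combination k1)
  have e2 : z2 = (3 * x + 5) * (4 * x + 1) * (4 * x + 2) * (x + 1) * x * (x - 1) * u :=
    mul_right_cancel₀ (show 3 * x + 4 ≠ 0 by positivity)
      (by linear_combination k2 + (x - 1) * e1)
  have f2 : c2 = (4 * x + 1) * (4 * x + 2) * (x - 2) * (x - 1) * x * (x + 1) * u :=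
    mul_right_cancel₀ (show 3 * x + 5 ≠ 0 by positivity)
      (by linear_combination k3 + (x - 2) * e2)
  have f3 : c3 = (4 * x + 1) * (4 * x + 2) * (4 * x + 3) * (x - 1) * x * (x + 1) * u :=
    mul_right_cancel₀ (show x - 2 ≠ 0 by linarith)
      (by linear_combination u3 + (4 * x + 3) * f2)
  have f4 : c4 = (4 * x + 1) * (4 * x + 2) * (4 * x + 3) * (4 * x + 4) * x * (x + 1) * u :=
    mul_right_cancel₀ (show x - 1 ≠ 0 by linarith)
      (by linear_combination u4 + (4 * x + 4) * f3)
  have f5 : c5 = (4 * x + 1) * (4 * x + 2) * (4 * x + 3) * (4 * x + 4) * (4 * x + 5) * (x + 1) * u :=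
    mul_right_cancel₀ (show x ≠ 0 by linarith)
      (by linear_combination u5 + (4 * x + 5) * f4)
  have f6 : c6 = (4 * x + 1) * (4 * x + 2) * (4 * x + 3) * (4 * x + 4) * (4 * x + 5) *
      (4 * x + 6) * u :=
    mul_right_cancel₀ (show x + 1 ≠ 0 by positivity)
      (by linear_combination u6 + (4 * x + 6) * f5)
  have f1 : c1 = (4 * x + 1) * (x - 3) * (x - 2) * (x - 1) * x * (x + 1) * u :=
    mul_right_cancel₀ (show 4 * x + 2 ≠ 0 by positivity)
      (by linear_combination -u2 + (x - 3) * f2)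
  have g1 : y' = (3 * x + 3) * (3 * x + 4) * (3 * x + 5) * x * (4 * x + 1) * (x + 1) * u :=
    mul_right_cancel₀ (show 4 * x + 2 ≠ 0 by positivity) (by linear_combination -v2)
  have g0 : y'' = (3 * x + 3) * (3 * x + 4) * (3 * x + 5) * x * (x - 1) * (x + 1) * u :=
    mul_right_cancel₀ (show 4 * x + 1 ≠ 0 by positivity)
      (by linear_combination -v1 + (x - 1) * g1)
  exact ⟨u, hu, rfl, g1, g0, f6, f5, f4, f3, f2, f1⟩

/-- The suffix is 2 - r. Divided by the common unit, the difference is a polynomial in m; at m = 78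
+ t, with 78 the threshold, it has no negative coefficient in t. The next two lemmas work alike. -/
lemma lagrangeCoeff_lt_zero {m : ℕ} (hm : 78 ≤ m) :
    (m + 1) * lagrangeCoeff 3 (3 * m + 5) (m + 1) <
      (m + 2) * (3 * m + 11) * lagrangeCoeff 0 (3 * m + 2) m := by
  obtain ⟨u, hu, y2, -, -, c6, c5, c4, c3, -, -⟩ := exists_binomial_unit (show 4 ≤ m by omega)
  have h1 : lagrangeCoeff 3 (3 * m + 5) (m + 1) =
      (4 * m + 6).choose (3 * m + 5) + 24 * (4 * m + 5).choose (3 * m + 5) + 192 * (4 * m + 4).choose (3 * m + 5) + 512 * (4 * m + 3).choose (3 * m + 5) := by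
    obtain ⟨k, rfl⟩ := Nat.exists_eq_add_of_le' (show 2 ≤ m by omega)
    simp only [lagrangeCoeff]
    ring_nf
  have h2 : lagrangeCoeff 0 (3 * m + 2) m =
      (4 * m + 2).choose (3 * m + 2) := by
    obtain ⟨k, rfl⟩ := Nat.exists_eq_add_of_le' (show 2 ≤ m by omega)
    simp only [lagrangeCoeff]
    ring_nf
  rw [h1, h2, ← Nat.cast_lt (α := ℚ)]
  push_cast
  rw [y2, c6, c5, c4, c3]
  obtain ⟨t, rfl⟩ := Nat.exists_eq_add_of_le' hm
  push_cast
  rw [← sub_pos]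
  have ht : (0 : ℚ) ≤ t := t.cast_nonneg
  generalize (t : ℚ) = x at ht
  ring_nf
  positivity

lemma lagrangeCoeff_lt_one {m : ℕ} (hm : 75 ≤ m) :
    (m + 1) * lagrangeCoeff 4 (3 * m + 5) (m + 1) <
      (m + 2) * (3 * m + 19) * lagrangeCoeff 1 (3 * m + 2) m := by
  obtain ⟨u, hu, y2, y1, -, c6, c5, c4, c3, c2, -⟩ := exists_binomial_unit (show 4 ≤ m by omega)
  have h1 : lagrangeCoeff 4 (3 * m + 5) (m + 1) =
      (4 * m + 6).choose (3 * m + 5) + 32 * (4 * m + 5).choose (3 * m + 5) + 384 * (4 * m + 4).choose (3 * m + 5) + 2048 * (4 * m + 3).choose (3 * m + 5) + 4096 * (4 * m + 2).choose (3 * m + 5) := by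
    obtain ⟨k, rfl⟩ := Nat.exists_eq_add_of_le' (show 3 ≤ m by omega)
    simp only [lagrangeCoeff]
    ring_nf
  have h2 : lagrangeCoeff 1 (3 * m + 2) m =
      (4 * m + 2).choose (3 * m + 2) + 8 * (4 * m + 1).choose (3 * m + 2) := by
    obtain ⟨k, rfl⟩ := Nat.exists_eq_add_of_le' (show 2 ≤ m by omega)
    simp only [lagrangeCoeff]
    ring_nf
  rw [h1, h2, ← Nat.cast_lt (α := ℚ)]
  push_cast
  rw [y2, y1, c6, c5, c4, c3, c2]
  obtain ⟨t, rfl⟩ := Nat.exists_eq_add_of_le' hm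
  push_cast
  rw [← sub_pos]
  have ht : (0 : ℚ) ≤ t := t.cast_nonneg
  generalize (t : ℚ) = x at ht
  ring_nf
  positivity

lemma lagrangeCoeff_lt_two {m : ℕ} (hm : 70 ≤ m) :
    (m + 1) * lagrangeCoeff 5 (3 * m + 5) (m + 1) <
      (m + 2) * (3 * m + 27) * lagrangeCoeff 2 (3 * m + 2) m := by
  obtain ⟨u, hu, y2, y1, y0, c6, c5, c4, c3, c2, c1⟩ := exists_binomial_unit (show 4 ≤ m by omega)
  have h1 : lagrangeCoeff 5 (3 * m + 5) (m + 1) =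
      (4 * m + 6).choose (3 * m + 5) + 40 * (4 * m + 5).choose (3 * m + 5) + 640 * (4 * m + 4).choose (3 * m + 5) + 5120 * (4 * m + 3).choose (3 * m + 5) + 20480 * (4 * m + 2).choose (3 * m + 5) + 32768 * (4 * m + 1).choose (3 * m + 5) := by
    obtain ⟨k, rfl⟩ := Nat.exists_eq_add_of_le' (show 4 ≤ m by omega)
    simp only [lagrangeCoeff]
    ring_nf
  have h2 : lagrangeCoeff 2 (3 * m + 2) m =
      (4 * m + 2).choose (3 * m + 2) + 16 * (4 * m + 1).choose (3 * m + 2) + 64 * (4 * m).choose (3 * m + 2) := by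
    obtain ⟨k, rfl⟩ := Nat.exists_eq_add_of_le' (show 2 ≤ m by omega)
    simp only [lagrangeCoeff]
    ring_nf
  rw [h1, h2, ← Nat.cast_lt (α := ℚ)]
  push_cast
  rw [y2, y1, y0, c6, c5, c4, c3, c2, c1]
  obtain ⟨t, rfl⟩ := Nat.exists_eq_add_of_le' hm
  push_cast
  rw [← sub_pos]
  have ht : (0 : ℚ) ≤ t := t.cast_nonneg
  generalize (t : ℚ) = x at ht
  ring_nf
  positivity

end MinimumWeight

end TernaryCode

/-! ### Computed extremal weight enumerators. -/

namespace TernaryCode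

section Certificates

open Polynomial

/-- The polynomial with the given list of coefficients. -/
noncomputable def listPoly : List ℤ → ℂ[X]
  | [] => 0
  | a :: l => C (a : ℂ) + X * listPoly l

/-- Coefficients of the product with `1 + c X` (and `c * p` added). -/
def listMulLin (c : ℤ) : ℤ → List ℤ → List ℤ
  | p, [] => [c * p]
  | p, a :: l => (a + c * p) :: listMulLin c a l

/-- Coefficients of `c * P + Q`. -/
def listAddMul (c : ℤ) : List ℤ → List ℤ → List ℤ
  | [], l => l
  | a :: k, [] => (c * a) :: listAddMul c k []
  | a :: k, b :: l => (c * a + b) :: listAddMul c k l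

/-- Coefficients of the product with `(1 + c X) ^ e`. -/
def listMulPow (c : ℤ) (e : ℕ) (l : List ℤ) : List ℤ := (listMulLin c 0)^[e] l

/-- Coefficients of `∑ aᵢ (1 + 8 z) ^ (3 (k - 1 - i)) (z (1 - z)³) ^ i` and of
`(1 + 8 z) ^ (3 k)`, where `k` is the length of the list of the `aᵢ`. -/
def listGleason : List ℤ → List ℤ × List ℤ
  | [] => ([], [1])
  | a :: l => match listGleason l with
    | (S, P) => (listAddMul a P (0 :: listMulPow (-1) 3 S), listMulPow 8 3 P)

/-- Coefficients of the truncated quotient by `1 - c X` (with `p` as incoming carry). -/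
def listDivLin (c : ℤ) : ℤ → List ℤ → List ℤ
  | _, [] => []
  | p, a :: l => (a + c * p) :: listDivLin c (a + c * p) l

/-- Expansion in powers of `z (1 - z)³ / (1 + 8 z)³` of a truncated power series in `z`. -/
def listExpand : ℕ → List ℤ → List ℤ
  | 0, _ => []
  | _, [] => []
  | k + 1, a :: l =>
    a :: listExpand k ((listMulPow 8 3 ((listDivLin 1 0)^[3] l)).take k)

/-- The Gleason coordinates of the extremal weight enumerator of length `12 m + 4 r`. -/
def extremalCoords (m r : ℕ) : List ℤ :=
  -- Modulo z ^ (m + 1) the enumerator is 1, so its coordinates are those of (1 + 8z) ^ (-(3m + r))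
  -- in powers of z (1 - z)³ / (1 + 8z)³.
  listExpand (m + 1) ((listDivLin (-8) 0)^[3 * m + r] (1 :: List.replicate m 0))

/-- The extremal weight enumerator of length `12 m + 4 r`. -/
def extremalEnumerator (m r : ℕ) : List ℤ :=
  listMulPow 8 r (listGleason (extremalCoords m r)).1

lemma listPoly_coeff (l : List ℤ) (j : ℕ) : (listPoly l).coeff j = (l.getD j 0 : ℤ) := by
  induction l generalizing j with
  | nil => simp [listPoly]
  | cons a l ih =>
    cases j with
    | zero => simp [listPoly]
    | succ j =>
      rw [listPoly, coeff_add, coeff_X_mul, ih, coeff_C_succ, zero_add, List.getD_cons_succ]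

lemma listPoly_mulLin (c p : ℤ) (l : List ℤ) :
    listPoly (listMulLin c p l) = listPoly l * (1 + C (c : ℂ) * X) + C ((c * p : ℤ) : ℂ) := by
  induction l generalizing p with
  | nil => simp [listMulLin, listPoly]
  | cons a l ih =>
    simp only [listMulLin, listPoly, ih, Int.cast_add, Int.cast_mul, map_add, map_mul]
    ring

lemma listPoly_addMul (c : ℤ) (k l : List ℤ) :
    listPoly (listAddMul c k l) = C (c : ℂ) * listPoly k + listPoly l := by
  induction k generalizing l with
  | nil => simp [listAddMul, listPoly]
  | cons a k ih =>
    cases l with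
    | nil =>
      simp only [listAddMul, listPoly, ih, Int.cast_mul, map_mul]
      ring
    | cons b l =>
      simp only [listAddMul, listPoly, ih, Int.cast_add, Int.cast_mul, map_add, map_mul]
      ring

lemma listPoly_mulPow (c : ℤ) (e : ℕ) (l : List ℤ) :
    listPoly (listMulPow c e l) = (1 + C (c : ℂ) * X) ^ e * listPoly l := by
  induction e with
  | zero => simp [listMulPow]
  | succ e ih =>
    rw [listMulPow] at ih ⊢
    rw [Function.iterate_succ_apply', listPoly_mulLin, ih, mul_zero, Int.cast_zero, C_0, pow_succ]
    ring

lemma listGleason_cons (a : ℤ) (l : List ℤ) : listGleason (a :: l) =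
    (listAddMul a (listGleason l).2 (0 :: listMulPow (-1) 3 (listGleason l).1),
      listMulPow 8 3 (listGleason l).2) := rfl

lemma listPoly_gleason_snd (l : List ℤ) :
    listPoly (listGleason l).2 = (1 + 8 * X) ^ (3 * l.length) := by
  induction l with
  | nil => simp [listGleason, listPoly]
  | cons a l ih =>
    rw [listGleason_cons, listPoly_mulPow, ih, Int.cast_ofNat, C_ofNat, ← pow_add,
      List.length_cons]
    congr 1
    ring

lemma listPoly_gleason_fst (l : List ℤ) :
    listPoly (listGleason l).1 = ∑ i ∈ Finset.range l.length, C ((l.getD i 0 : ℤ) : ℂ) *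
      ((1 + 8 * X) ^ (3 * (l.length - 1 - i)) * (X * (1 - X) ^ 3) ^ i) := by
  have h1 : (1 + C ((-1 : ℤ) : ℂ) * X : ℂ[X]) = 1 - X := by
    simp [sub_eq_add_neg]
  induction l with
  | nil => simp [listGleason, listPoly]
  | cons a l ih =>
    have hs : ∑ i ∈ Finset.range l.length, C (((a :: l).getD (i + 1) 0 : ℤ) : ℂ) *
        ((1 + 8 * X) ^ (3 * (l.length + 1 - 1 - (i + 1))) * (X * (1 - X) ^ 3) ^ (i + 1)) =
        X * ((1 - X) ^ 3 * ∑ i ∈ Finset.range l.length, C ((l.getD i 0 : ℤ) : ℂ) *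
          ((1 + 8 * X) ^ (3 * (l.length - 1 - i)) * (X * (1 - X) ^ 3) ^ i)) := by
      rw [Finset.mul_sum, Finset.mul_sum]
      refine Finset.sum_congr rfl fun i _ => ?_
      rw [show l.length + 1 - 1 - (i + 1) = l.length - 1 - i by omega, List.getD_cons_succ]
      generalize (1 + 8 * X : ℂ[X]) ^ (3 * (l.length - 1 - i)) = P
      rw [pow_succ]
      generalize (X * (1 - X) ^ 3 : ℂ[X]) ^ i = Q
      ring
    rw [listGleason_cons, listPoly_addMul, listPoly_gleason_snd, listPoly, listPoly_mulPow, h1, ih,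
      Int.cast_zero, C_0, zero_add, List.length_cons, Finset.sum_range_succ', hs,
      List.getD_cons_zero, pow_zero, mul_one, Nat.add_sub_cancel, Nat.sub_zero]
    exact add_comm _ _

/-- The generators are triangular: the i-th starts with z ^ i. So the coefficients up to m determine
the coordinates. -/
lemma eq_zero_of_coeff_sum_eq_zero {m r : ℕ} {b : ℕ → ℂ}
    (h : ∀ j ≤ m, (∑ i ∈ Finset.range (m + 1),
      C (b i) * ((1 + 8 * X) ^ (3 * (m - i) + r) * (X * (1 - X) ^ 3) ^ i)).coeff j = 0) (i : ℕ) :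
    i ≤ m → b i = 0 := by
  induction i using Nat.strong_induction_on with
  | _ i ih =>
    intro hi
    have h1 := h i hi
    have hX : ∀ k, ((1 + 8 * X : ℂ[X]) ^ (3 * (m - k) + r) * (X * (1 - X) ^ 3) ^ k) =
        X ^ k * ((1 + 8 * X) ^ (3 * (m - k) + r) * ((1 - X) ^ 3) ^ k) := by
      intro k
      rw [mul_pow X]
      ring
    rw [finsetSum_coeff, Finset.sum_eq_single i] at h1
    · rw [coeff_C_mul, hX, coeff_X_pow_mul', if_pos le_rfl, Nat.sub_self,
        coeff_zero_eq_eval_zero] at h1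
      simpa using h1
    · intro k hk hki
      rw [coeff_C_mul]
      rcases Nat.lt_or_gt_of_ne hki with hlt | hgt
      · rw [ih k hlt (by omega), zero_mul]
      · rw [hX, coeff_X_pow_mul', if_neg (by omega), mul_zero]
    · intro hk
      exact (hk (Finset.mem_range.2 (by omega))).elim

/-- If the computed enumerator starts with `1, 0, …, 0`, it is the weight enumerator. -/
theorem IsExtremalTypeIII.card_eq_getD {n m r : ℕ} {C : LinearCode n} (hC : IsExtremalTypeIII C)
    (hn : n = 12 * m + 4 * r) (hr : r ≤ 2) (hlen : (extremalCoords m r).length = m + 1)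
    (hinit : (extremalEnumerator m r).take (m + 1) = 1 :: List.replicate m 0) (j : ℕ) :
    ((supportDesign C (3 * j)).card : ℤ) = (extremalEnumerator m r).getD j 0 := by
  obtain ⟨a, ha⟩ := hC.1.exists_weightEnumerator hn hr
  have hE : listPoly (extremalEnumerator m r) = ∑ i ∈ Finset.range (m + 1),
      Polynomial.C (((extremalCoords m r).getD i 0 : ℤ) : ℂ) *
        ((1 + 8 * X) ^ (3 * (m - i) + r) * (X * (1 - X) ^ 3) ^ i) := by
    rw [extremalEnumerator, listPoly_mulPow, listPoly_gleason_fst, hlen, Finset.mul_sum]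
    refine Finset.sum_congr rfl fun i _ => ?_
    rw [Int.cast_ofNat, C_ofNat, Nat.add_sub_cancel, pow_add]
    ring
  have hE0 : ∀ j ≤ m, (extremalEnumerator m r).getD j 0 = if j = 0 then 1 else 0 := by
    intro j hj
    have h1 : ((extremalEnumerator m r).take (m + 1)).getD j 0 =
        (extremalEnumerator m r).getD j 0 := by
      simp [List.getD_eq_getElem?_getD, Nat.lt_succ_iff.2 hj]
    rw [← h1, hinit]
    cases j with
    | zero => simp
    | succ j => simp [List.getD_eq_getElem?_getD, show j < m by omega]
  have hR0 : ∀ j ≤ m, ((supportDesign C (3 * j)).card : ℂ) = if j = 0 then 1 else 0 := by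
    intro j hj
    split_ifs with h0
    · rw [h0, mul_zero, card_supportDesign_zero, Nat.cast_one]
    · rw [hC.card_supportDesign_eq_zero (by omega) (by omega) hj, Nat.cast_zero]
  have hdiff : ∀ (x y : ℕ → ℂ), (∑ i ∈ Finset.range (m + 1), Polynomial.C (x i - y i) *
      ((1 + 8 * X) ^ (3 * (m - i) + r) * (X * (1 - X) ^ 3) ^ i)) =
      (∑ i ∈ Finset.range (m + 1), Polynomial.C (x i) *
        ((1 + 8 * X) ^ (3 * (m - i) + r) * (X * (1 - X) ^ 3) ^ i)) -
      ∑ i ∈ Finset.range (m + 1), Polynomial.C (y i) *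
        ((1 + 8 * X) ^ (3 * (m - i) + r) * (X * (1 - X) ^ 3) ^ i) := by
    intro x y
    simp only [C_sub, sub_mul, Finset.sum_sub_distrib]
  -- Uniqueness suffices: the coordinates act as a certificate, checked through `hinit`, and the
  -- correctness of `listExpand` is not needed.
  have hzero := eq_zero_of_coeff_sum_eq_zero (m := m) (r := r)
    (b := fun i => a i - (((extremalCoords m r).getD i 0 : ℤ) : ℂ)) (by
      intro j hj
      rw [hdiff, coeff_sub, ← ha, hR0 j hj, ← hE, listPoly_coeff, hE0 j hj]
      split_ifs <;> simp)
  have hsum : (∑ i ∈ Finset.range (m + 1), Polynomial.C (a i) *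
      ((1 + 8 * X) ^ (3 * (m - i) + r) * (X * (1 - X) ^ 3) ^ i)) =
      listPoly (extremalEnumerator m r) := by
    rw [hE]
    refine Finset.sum_congr rfl fun i hi => ?_
    rw [sub_eq_zero.1 (hzero i (Nat.lt_succ_iff.1 (Finset.mem_range.1 hi)))]
  have := ha j
  rw [hsum, listPoly_coeff] at this
  exact_mod_cast this

-- Index 170 stands for weight 510 in length 512.
set_option maxRecDepth 1000000 in
lemma extremalEnumerator_42 : (extremalCoords 42 2).length = 43 ∧
    (extremalEnumerator 42 2).take 43 = 1 :: List.replicate 42 0 ∧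
    (extremalEnumerator 42 2).getD 170 0 < 0 := by
  decide +kernel

-- Index 85 stands for weight 255 in length 764; the last clause refutes the integrality condition
-- of a 7-design.
set_option maxRecDepth 1000000 in
lemma extremalEnumerator_63 : (extremalCoords 63 2).length = 64 ∧
    (extremalEnumerator 63 2).take 64 = 1 :: List.replicate 63 0 ∧
    ¬ ((Nat.descFactorial 764 7 : ℕ) : ℤ) ∣
      (extremalEnumerator 63 2).getD 85 0 * (Nat.descFactorial 255 7 : ℕ) := by
  decide +kernel

end Certificates

end TernaryCode

/-! ### Integrality conditions in minimum weight. -/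

namespace TernaryCode

section Divisibility

/-- `lagrangeCoeff`, with the binomial coefficients evaluated as quotients of factorials. -/
def lagrangeCoeffQuot : ℕ → ℕ → ℕ → ℕ
  | 0, s, k => (s + k).descFactorial k / k.factorial
  | _ + 1, _, 0 => 1
  | e + 1, s, k + 1 => lagrangeCoeffQuot e s (k + 1) + 8 * lagrangeCoeffQuot e s k

lemma lagrangeCoeffQuot_eq (e s k : ℕ) : lagrangeCoeffQuot e s k = lagrangeCoeff e s k := by
  induction e generalizing k with
  | zero =>
    rw [lagrangeCoeffQuot, lagrangeCoeff, ← Nat.choose_eq_descFactorial_div_factorial,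
      Nat.choose_symm_add]
  | succ e ih =>
    cases k with
    | zero => rfl
    | succ k => rw [lagrangeCoeffQuot, lagrangeCoeff, ih, ih]

/-- The divisibility condition satisfied by `m` and `r` if the codewords of minimum weight of an
extremal code of length `12 m + 4 r` form a `t`-design. -/
def MinWeightDesignCondition (m r t : ℕ) : Prop :=
  (m + 1) * (12 * m + 4 * r).descFactorial t ∣
    8 * (3 * m + r) * lagrangeCoeffQuot (2 - r) (3 * m + 2) m * (3 * m + 3).descFactorial t

instance (m r t : ℕ) : Decidable (MinWeightDesignCondition m r t) := by
  unfold MinWeightDesignCondition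
  infer_instance

variable {n m r : ℕ} {C : LinearCode n}

lemma IsExtremalTypeIII.minWeightDesignCondition (hC : IsExtremalTypeIII C)
    (hn : n = 12 * m + 4 * r) (hr : r ≤ 2) {t : ℕ} (ht : t ≤ 3 * m + 3) (htn : t ≤ n)
    (hvan : DiffSumsVanish C t) : MinWeightDesignCondition m r t := by
  rw [MinWeightDesignCondition, lagrangeCoeffQuot_eq, ← hC.card_min hn hr, mul_assoc, ← hn]
  exact mul_dvd_mul_left _ (hvan.descFactorial_dvd ht htn)

-- At m = 0 the condition degenerates to 0 ∣ 0, hence the exclusion; the bound 70 is that of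
-- `lagrangeCoeff_lt_two`.
set_option maxRecDepth 100000 in
lemma mem_of_condition_zero : ∀ m < 70, m ≠ 0 → MinWeightDesignCondition m 0 6 →
    m ∈ [15, 38, 43, 64] := by
  decide +kernel

set_option maxRecDepth 100000 in
lemma not_condition_zero : ∀ m ∈ [15, 38, 43, 64], ¬ MinWeightDesignCondition m 0 8 := by
  decide +kernel

set_option maxRecDepth 100000 in
lemma mem_of_condition_one : ∀ m < 75, m ≠ 0 → MinWeightDesignCondition m 1 4 →
    m ∈ [11, 18, 21, 25, 32, 39, 43, 46, 49, 54, 60, 65, 67, 68, 74] := by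
  decide +kernel

set_option maxRecDepth 100000 in
lemma not_condition_one : ∀ m ∈ [11, 18, 21, 25, 32, 39, 43, 46, 49, 54, 60, 65, 68, 74],
    ¬ MinWeightDesignCondition m 1 6 := by
  decide +kernel

set_option maxRecDepth 100000 in
lemma not_condition_one' : ¬ MinWeightDesignCondition 67 1 7 := by
  decide +kernel

set_option maxRecDepth 100000 in
lemma mem_of_condition_two : ∀ m < 78, MinWeightDesignCondition m 2 2 →
    m ∈ [14, 37, 42, 63] := by
  decide +kernel

set_option maxRecDepth 100000 in
lemma not_condition_two : ∀ m ∈ [14, 37, 42, 63], ¬ MinWeightDesignCondition m 2 4 := by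
  decide +kernel

end Divisibility

/-! ### The alternatives for δ and s, exceptional lengths, conclusion. -/

section Main

open Polynomial

variable {n m r : ℕ} {C : LinearCode n}

lemma IsExtremalTypeIII.ne_zero (hC : IsExtremalTypeIII C) : n ≠ 0 := by
  rintro rfl
  obtain ⟨x, -, hx, -⟩ := hC.2.1
  exact hx (Subsingleton.elim _ _)

lemma IsExtremalTypeIII.diffSumsVanish (hC : IsExtremalTypeIII C) (hn : n = 12 * m + 4 * r)
    (hr : r ≤ 2) {t : ℕ} (ht : t + 2 * r < 6) (htD : t ≤ 3 * m + 3) : DiffSumsVanish C t :=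
  fun _ hl hne hle => hC.diffSum_eq_zero hn hr hl hne (by omega) (Or.inl (by omega))

lemma IsExtremalTypeIII.diffSumsVanish_succ (hC : IsExtremalTypeIII C) (hn : n = 12 * m + 4 * r)
    (hr : r ≤ 2) {t : ℕ} (ht : t + 2 * r = 6) (htD : t + 1 ≤ 3 * m + 3)
    (hvan : DiffSumsVanish C t) : DiffSumsVanish C (t + 1) :=
  hvan.succ fun _ hl hlen => hC.diffSum_eq_zero hn hr hl (by rintro rfl; simp at hlen) (by omega)
    (Or.inr (by omega))

lemma coeff_one_sub_pow_ne_zero {d j : ℕ} (hj : j ≤ d) :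
    ((1 - X : ℂ[X]) ^ d * 1).coeff j ≠ 0 := by
  rw [mul_one, coeff_one_sub_pow]
  exact mul_ne_zero (pow_ne_zero _ (by norm_num))
    (Nat.cast_ne_zero.2 (Nat.choose_pos hj).ne')

/-- The alternative given by the first degree in which an obstruction is possible. -/
lemma IsExtremalTypeIII.first_alternative (hC : IsExtremalTypeIII C) (hn : n = 12 * m + 4 * r)
    (hr : r ≤ 2) {t : ℕ} (ht : t + 1 + 2 * r = 6) (htD : t + 1 ≤ 3 * m + 3) :
    (delta C = t ∧ s C = t) ∨ MinWeightDesignCondition m r (t + 1) ∧ DiffSumsVanish C (t + 1) := by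
  have h0 := hC.ne_zero
  rcases hC.vanish_or_eq hn hr htD (by omega) (hC.diffSumsVanish hn hr (by omega) (by omega))
    (Or.inl ⟨ht, rfl⟩) (fun j hj => coeff_one_sub_pow_ne_zero (by omega)) with h | h
  · exact Or.inr ⟨hC.minWeightDesignCondition hn hr htD (by omega) h, h⟩
  · exact Or.inl h

/-- The alternative given by the second degree in which an obstruction is possible. -/
lemma IsExtremalTypeIII.second_alternative (hC : IsExtremalTypeIII C) (hn : n = 12 * m + 4 * r)
    (hr : r ≤ 2) {t : ℕ} (ht : t + 1 + 2 * r = 8) (htD : t + 1 ≤ 3 * m + 3)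
    (h9 : ¬ 9 ∣ 3 * m + 3 - t) (hvan : DiffSumsVanish C t) :
    (delta C = t ∧ s C = t) ∨ MinWeightDesignCondition m r (t + 1) ∧ DiffSumsVanish C (t + 1) := by
  rcases hC.vanish_or_eq hn hr htD (by omega) hvan (Or.inr (Or.inl ⟨ht, rfl⟩))
    (fun j hj => coeff_one_sub_pow_mul_ne_zero (by omega) (by omega)) with h | h
  · exact Or.inr ⟨hC.minWeightDesignCondition hn hr htD (by omega) h, h⟩
  · exact Or.inl h

/-- No obstruction is involved: the bound is the block size 3 of the minimum weight design. -/
lemma IsExtremalTypeIII.delta_of_length_four {C : LinearCode 4} (hC : IsExtremalTypeIII C) :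
    delta C = 3 := by
  have hvan := hC.diffSumsVanish (m := 0) (r := 1) rfl (by norm_num) (t := 3) (by norm_num) le_rfl
  refine IsGreatest.csSup_eq ⟨?_, ?_⟩
  · intro w hw0 hw
    obtain ⟨j, rfl⟩ := hC.exists_of_ne_zero (m := 0) rfl hw0 hw
    exact hvan.isDesign (by omega)
  · intro u hu
    exact (hu 3 (by norm_num) (hC.supportDesign_min_ne_zero (m := 0) rfl)).1

/-- There is no extremal code of length `512`: the number of its codewords of weight `510` would
be negative. -/
lemma not_isExtremalTypeIII_512 (C : LinearCode n) (hn : n = 12 * 42 + 4 * 2) :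
    ¬ IsExtremalTypeIII C := by
  intro hC
  obtain ⟨h1, h2, h3⟩ := extremalEnumerator_42
  rw [← hC.card_eq_getD hn le_rfl h1 h2 170] at h3
  omega

/-- The case m = 67, r = 1 in degree 7, where d = 3 · 67 + 3 - 7 = 197. -/
lemma coeff_obstruction_197_ne_zero {j : ℕ} (hj : j ≤ 199) :
    ((1 - X : ℂ[X]) ^ 197 * (1 - 20 * X - 8 * X ^ 2)).coeff j ≠ 0 := by
  refine coeff_one_sub_pow_mul_ne_zero' hj fun i hi => ?_
  have h : ∀ i : ℕ, i < 198 → ((197 : ℕ) - (i : ℤ)) * ((197 : ℕ) - (i : ℤ) - 1) +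
      20 * ((i : ℤ) + 2) * ((197 : ℕ) - (i : ℤ)) - 8 * ((i : ℤ) + 1) * ((i : ℤ) + 2) ≠ 0 := by
    decide +kernel
  exact_mod_cast h i (by omega)

/-- The extremal codes of length `764` whose `D_w` are `2`-designs: `D_255` is a nontrivial
`4`-design, but not a `7`-design. -/
lemma IsExtremalTypeIII.delta_s_of_length_764 (hC : IsExtremalTypeIII C)
    (hn : n = 12 * 63 + 4 * 2) (hvan : DiffSumsVanish C 3) :
    delta C = 3 ∧ 4 ≤ s C ∧ s C ≤ 6 := by
  have hn12 : n / 12 = 63 := by omega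
  have hnot4 : ¬ DiffSumsVanish C 4 := fun h =>
    not_condition_two 63 (by simp)
      (hC.minWeightDesignCondition hn le_rfl (by norm_num) (by omega) h)
  have hcoeff : ∀ l : List (Fin n × Fin n), (points l).Nodup → l.length = 4 → ∃ c : ℂ, ∀ j,
      (diffSum l (supportDesign C (192 + 3 * j)) : ℂ) =
        c * ((1 - X : ℂ[X]) ^ 188 * (1 + 8 * X)).coeff j := by
    intro l hl hlen
    have := hC.exists_diffSum_eq (m := 63) hn le_rfl hl (by rintro rfl; simp at hlen)
      (by omega) (Or.inr (Or.inl ⟨by omega, rfl⟩))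
    rwa [hlen, show 3 * 63 + 3 - 4 = 188 by norm_num, show 3 * 63 + 3 = 192 by norm_num] at this
  obtain ⟨l, hl, hlen, hl'⟩ : ∃ l : List (Fin n × Fin n), (points l).Nodup ∧ l.length = 4 ∧
      ∃ w, diffSum l (supportDesign C w) ≠ 0 := by
    by_contra! h
    exact hnot4 (hvan.succ h)
  have hl0 : l ≠ [] := by rintro rfl; simp at hlen
  have hne : ∀ j, j ≤ 189 → j ≠ 21 → diffSum l (supportDesign C (192 + 3 * j)) ≠ 0 := by
    obtain ⟨c, hc⟩ := hcoeff l hl hlen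
    have hc0 : c ≠ 0 := by
      rintro rfl
      obtain ⟨w, hw⟩ := hl'
      refine hw (hC.diffSum_eq_zero_of_forall (m := 63) hn12 hl0 (fun j => ?_) w)
      have := hc j
      rw [zero_mul] at this
      exact_mod_cast this
    intro j hj h21 h0
    have := hc j
    rw [h0, Int.cast_zero] at this
    exact mul_ne_zero hc0 (coeff_one_sub_pow_mul_ne_zero (by omega) (by omega)) this.symm
  have h4 : IsDesign 4 255 (supportDesign C 255) := by
    refine isDesign_of_diffSum_eq_zero (by norm_num) (fun _ => card_of_mem_supportDesign)
      fun l hl hne hle => ?_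
    rcases Nat.lt_or_eq_of_le hle with hlt | heq
    · exact hvan l hl hne (by omega) 255
    · obtain ⟨c, hc⟩ := hcoeff l hl heq
      -- 9 · 21 = 188 + 1, so the degree 4 polynomial has a zero coefficient exactly at weight 192 +
      -- 3 · 21 = 255.
      have := hc 21
      rw [coeff_one_sub_pow_mul_eq_zero (by norm_num), mul_zero] at this
      exact_mod_cast this
  have h7 : ¬ IsDesign 7 255 (supportDesign C 255) := by
    intro h
    obtain ⟨h1, h2, h3⟩ := extremalEnumerator_63
    rw [← hC.card_eq_getD hn le_rfl h1 h2 85] at h3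
    have hdvd := h.descFactorial_dvd (by simp; omega)
    rw [Fintype.card_fin, show n.descFactorial 7 = Nat.descFactorial 764 7 by rw [hn]] at hdvd
    exact h3 (by exact_mod_cast hdvd)
  have hnt : ¬ IsTrivial 255 (supportDesign C 255) := fun h =>
    h7 (h.supportDesign_isDesign (by norm_num))
  have hmem : 4 ∈ {t : ℕ | ∃ w : ℕ, w ≠ 0 ∧ ¬ IsTrivial w (supportDesign C w) ∧
      IsDesign t w (supportDesign C w)} := ⟨255, by norm_num, hnt, h4⟩
  have hbdd : ∀ u ∈ {t : ℕ | ∃ w : ℕ, w ≠ 0 ∧ ¬ IsTrivial w (supportDesign C w) ∧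
      IsDesign t w (supportDesign C w)}, u ≤ 6 := by
    rintro u ⟨w, hw0, hntw, hdes⟩
    by_contra! h
    by_cases hw : w = 255
    · subst hw
      exact h7 (hdes.mono h)
    · have := hC.lt_of_isDesign hn12 hl0 hl hlen ?_ hw0 hntw hdes
      · omega
      · rintro j rfl hle
        exact hne j (by omega) (by omega)
  exact ⟨hC.delta_eq hn12 (by norm_num) hvan hl hlen (hne 0 (by norm_num) (by norm_num)),
    le_csSup ⟨6, hbdd⟩ hmem, csSup_le ⟨4, hmem⟩ hbdd⟩

end Main

end TernaryCode

theorem theorem1p1 (n m : ℕ) (C : TernaryCode.LinearCode n)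
    (hC : TernaryCode.IsExtremalTypeIII C) :
    (n = 12 * m →
      (m ∉ ({15, 38, 43, 64} : Set ℕ) →
        TernaryCode.delta C = 5 ∧ TernaryCode.s C = 5) ∧
      (m ∈ ({15, 38, 43, 64} : Set ℕ) →
        (TernaryCode.delta C = 5 ∧ TernaryCode.s C = 5) ∨
        (TernaryCode.delta C = 7 ∧ TernaryCode.s C = 7))) ∧
    (n = 12 * m + 4 →
      (m ∉ ({11, 18, 21, 25, 32, 39, 43, 46, 49, 54, 60, 65, 67, 68, 74} : Set ℕ) →
        TernaryCode.delta C = 3 ∧ (m ≠ 0 → TernaryCode.s C = 3)) ∧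
      (m ∈ ({11, 18, 21, 25, 32, 39, 43, 46, 49, 54, 60, 65, 68, 74} : Set ℕ) →
        (TernaryCode.delta C = 3 ∧ TernaryCode.s C = 3) ∨
        (TernaryCode.delta C = 5 ∧ TernaryCode.s C = 5)) ∧
      (m = 67 →
        (TernaryCode.delta C = 3 ∧ TernaryCode.s C = 3) ∨
        (TernaryCode.delta C = 5 ∧ TernaryCode.s C = 5) ∨
        (TernaryCode.delta C = 6 ∧ TernaryCode.s C = 6))) ∧
    (n = 12 * m + 8 →
      (m ∉ ({14, 37, 42, 63} : Set ℕ) →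
        TernaryCode.delta C = 1 ∧ TernaryCode.s C = 1) ∧
      (m ∈ ({14, 37, 42} : Set ℕ) →
        (TernaryCode.delta C = 1 ∧ TernaryCode.s C = 1) ∨
        (TernaryCode.delta C = 3 ∧ TernaryCode.s C = 3)) ∧
      (m = 63 →
        (TernaryCode.delta C = 1 ∧ TernaryCode.s C = 1) ∨
        (TernaryCode.delta C = 3 ∧ 4 ≤ TernaryCode.s C ∧ TernaryCode.s C ≤ 6))) := by
  refine ⟨?_, ?_, ?_⟩
  · intro hn
    have hn' : n = 12 * m + 4 * 0 := hn
    have h0 := hC.ne_zero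
    have hm : m < 70 := by
      by_contra! h
      exact (hC.lagrangeCoeff_le hn' (by norm_num)).not_gt (TernaryCode.lagrangeCoeff_lt_two h)
    rcases hC.first_alternative hn' (by norm_num) (t := 5) rfl (by omega) with h | ⟨hcond, hvan⟩
    · exact ⟨fun _ => h, fun _ => Or.inl h⟩
    have hmem := TernaryCode.mem_of_condition_zero m hm (by omega) hcond
    have hnot := TernaryCode.not_condition_zero m hmem
    refine ⟨fun h => (h (by simpa using hmem)).elim, fun _ => Or.inr ?_⟩
    simp only [List.mem_cons, List.not_mem_nil, or_false] at hmem
    -- Degree 7 comes for free, as there are no invariants of degree 2. In degree 8 no coefficient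
    -- vanishes, because 3m + 3 - 7 is not divisible by 3.
    have hvan7 := hC.diffSumsVanish_succ hn' (by norm_num) rfl (by omega) hvan
    exact (hC.second_alternative hn' (by norm_num) (t := 7) rfl (by omega) (by omega)
      hvan7).resolve_right fun h => hnot h.1
  · intro hn
    have hn' : n = 12 * m + 4 * 1 := hn
    rcases Nat.eq_zero_or_pos m with rfl | hpos
    · subst hn
      exact ⟨fun _ => ⟨hC.delta_of_length_four, fun h => (h rfl).elim⟩, fun h => by simp at h,
        fun h => by simp at h⟩
    have hm : m < 75 := by
      by_contra! h
      exact (hC.lagrangeCoeff_le hn' (by norm_num)).not_gt (TernaryCode.lagrangeCoeff_lt_one h)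
    rcases hC.first_alternative hn' (by norm_num) (t := 3) rfl (by omega) with h | ⟨hcond, hvan⟩
    · exact ⟨fun _ => ⟨h.1, fun _ => h.2⟩, fun _ => Or.inl h, fun _ => Or.inl h⟩
    have hmem := TernaryCode.mem_of_condition_one m hm (by omega) hcond
    refine ⟨fun h => (h (by simpa using hmem)).elim, ?_⟩
    have hm11 : 11 ≤ m := by
      simp only [List.mem_cons, List.not_mem_nil, or_false] at hmem
      omega
    have hvan5 := hC.diffSumsVanish_succ hn' (by norm_num) rfl (by omega) hvan
    rcases hC.second_alternative hn' (by norm_num) (t := 5) rfl (by omega) (by omega) hvan5 with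
      h | ⟨hcond6, hvan6⟩
    · exact ⟨fun _ => Or.inr h, fun _ => Or.inr (Or.inl h)⟩
    refine ⟨fun h => (TernaryCode.not_condition_one m (by simpa using h) hcond6).elim, ?_⟩
    rintro rfl
    refine Or.inr (Or.inr ?_)
    refine (hC.vanish_or_eq hn' (by norm_num) (t := 6) (by omega) (by omega) hvan6
      (Or.inr (Or.inr ⟨rfl, rfl⟩)) fun j hj => ?_).resolve_left fun h => ?_
    · rw [show 3 * 67 + 3 - (6 + 1) = 197 by norm_num]
      exact TernaryCode.coeff_obstruction_197_ne_zero (by omega)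
    exact TernaryCode.not_condition_one'
      (hC.minWeightDesignCondition hn' (by norm_num) (by norm_num) (by omega) h)
  · intro hn
    have hn' : n = 12 * m + 4 * 2 := hn
    have hm : m < 78 := by
      by_contra! h
      exact (hC.lagrangeCoeff_le hn' le_rfl).not_gt (TernaryCode.lagrangeCoeff_lt_zero h)
    rcases hC.first_alternative hn' le_rfl (t := 1) rfl (by omega) with h | ⟨hcond, hvan⟩
    · refine ⟨fun _ => h, fun _ => Or.inl h, fun _ => Or.inl h⟩
    have hmem := TernaryCode.mem_of_condition_two m hm hcond
    have hnot := TernaryCode.not_condition_two m hmem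
    refine ⟨fun h => (h (by simpa using hmem)).elim, ?_⟩
    simp only [List.mem_cons, List.not_mem_nil, or_false] at hmem
    have hvan3 := hC.diffSumsVanish_succ hn' le_rfl rfl (by omega) hvan
    by_cases h63 : m = 63
    · subst h63
      exact ⟨fun h => by simp at h, fun _ => Or.inr (hC.delta_s_of_length_764 hn' hvan3)⟩
    -- For m = 42 the number 3m + 3 - 3 = 126 is divisible by 9 and a coefficient vanishes, so
    -- `second_alternative` is not available; the case is void instead.
    by_cases h42 : m = 42
    · subst h42
      exact (TernaryCode.not_isExtremalTypeIII_512 C hn' hC).elim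
    refine ⟨fun _ => Or.inr ?_, fun h => (h63 h).elim⟩
    exact (hC.second_alternative hn' le_rfl (t := 3) rfl (by omega) (by omega)
      hvan3).resolve_right fun h => hnot h.1
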